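/- Let $n\ge 1$, let $U^n=\{z\in\mathbb C^n: |z_j|<1 \text{ for all } j\}$, and let $dm_{2n}$ be Lebesgue measure on $U^n$. For $1\le j\le n$ let $\omega_j$ be a non-negative measurable function on $(0,1)$ for which there are $m_j,q_j\in(0,1)$ and $M_j>0$ with $$m_j\le \frac{\omega_j(\lambda r)}{\omega_j(r)}\le M_j\qquad (r\in(0,1),\ \lambda\in[q_j,1]),$$ and put $\alpha_{\omega_j}=-\log m_j/\log q_j^{-1}$. Assume moreover that for each $j$ there are $\beta_j<-1$ and $K_j$ with $\omega_j(\lambda r)\le K_j\lambda^{-\beta_j}\omega_j(r)$ for all $r\in(0,1)$, $\lambda\in(0,1]$. Let $0<p<1$. Let $L_p(\omega)$ be the space of measurable functions $f$ on $U^n$ with $$\|f\|_{L_p(\omega)}^p=\int_{U^n}|f(z)|^p\prod_{j=1}^n\frac{\omega_j(1-|z_j|)}{(1-|z_j|^2)^2}\,dm_{2n}(z)<\infty ,$$ and let $B_p(\omega)$ be the space of holomorphic functions $f$ on $U^n$ with $$\|f\|_{B_p(\omega)}^p=\int_{U^n}|Df(z)|^p\prod_{j=1}^n\frac{\omega_j(1-|z_j|)}{(1-|z_j|^2)^{2-p}}\,dm_{2n}(z)<\infty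 ,\qquad Df(z)=\frac{\partial^n\big(z_1\cdots z_n f(z)\big)}{\partial z_1\cdots\partial z_n}.$$ Let $\overline B_p(\omega)=\{\overline f: f\in B_p(\omega)\}$, with $\|\overline f\|_{\overline B_p(\omega)}=\|f\|_{B_p(\omega)}$. For $\alpha=(\alpha_1,\dots,\alpha_n)\in\mathbb R^n$, $g\in L^\infty(U^n)$ and a function $f$ on $U^n$ put $$B^\alpha_g f(z)=\frac{1}{\pi^n}\prod_{j=1}^n(\alpha_j+1)(1-|z_j|^2)^{\alpha_j+2}\int_{U^n}\prod_{j=1}^n\frac{(1-|\zeta_j|^2)^{\alpha_j}}{|1-z_j\overline{\zeta_j}|^{4+2\alpha_j}}\,f(\zeta)g(\zeta)\,dm_{2n}(\zeta).$$ Theorem. If $\alpha_j>\alpha_{\omega_j}/p-2$ for $1\le j\le n$, then there is a constant $C$, depending only on $n,p,\alpha$ and $\omega$, such that for all $g\in L^\infty(U^n)$ and all $f\in B_p(\omega)$ the integral defining $B^\alpha_g f(z)$ converges absolutely for every $z\in U^n$, $B^\alpha_g f\in L_p(\omega)$, and $$\|B^\alpha_g f\|_{L_p(\omega)}\le C\,\|g\|_\infty\,\|f\|_{B_p(\omega)}.$$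 The same holds for all $f\in\overline B_p(\omega)$, with $\|f\|_{\overline B_p(\omega)}$ in place of $\|f\|_{B_p(\omega)}$. -/

import Mathlib

open MeasureTheory

namespace WeightedBesov

/-- The unit polydisc `U^n` in `ℂ^n`. -/
def polydisc (n : ℕ) : Set (Fin n → ℂ) := {z | ∀ j, ‖z j‖ < 1}

/-- `ω` belongs to the class `S` with the constants `m`, `q`, `M`: it is a non-negative measurable
function on `(0,1)` with `m ≤ ω (l * r) / ω r ≤ M` for all `r ∈ (0,1)` and `l ∈ [q,1]`.
(The lower bound with `m > 0` forces `ω r ≠ 0`, so the quotient is a genuine one.) -/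
structure IsClassS (ω : ℝ → ℝ) (m q M : ℝ) : Prop where
  measurable : Measurable (fun t : Set.Ioo (0 : ℝ) 1 => ω t)
  nonneg : ∀ r ∈ Set.Ioo (0 : ℝ) 1, 0 ≤ ω r
  m_mem : m ∈ Set.Ioo (0 : ℝ) 1
  q_mem : q ∈ Set.Ioo (0 : ℝ) 1
  M_pos : 0 < M
  lower : ∀ r ∈ Set.Ioo (0 : ℝ) 1, ∀ l ∈ Set.Icc q 1, m ≤ ω (l * r) / ω r
  upper : ∀ r ∈ Set.Ioo (0 : ℝ) 1, ∀ l ∈ Set.Icc q 1, ω (l * r) / ω r ≤ M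

/-- The index `α_ω`, given by `-α_ω = log m / log (1/q)`. -/
noncomputable def alphaIndex (m q : ℝ) : ℝ := -(Real.log m / Real.log q⁻¹)

/-- `β` is an upper exponent of `ω`: up to a constant factor, `ω (l * r)` is at most
`l ^ (-β) * ω r` for all `r ∈ (0,1)` and `l ∈ (0,1]`. -/
def HasUpperExponent (ω : ℝ → ℝ) (β : ℝ) : Prop :=
  ∃ K : ℝ, ∀ r ∈ Set.Ioo (0 : ℝ) 1, ∀ l ∈ Set.Ioc (0 : ℝ) 1, ω (l * r) ≤ K * l ^ (-β) * ω r

/-- The complex partial derivative `∂F/∂z_j`. -/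
noncomputable def partialDeriv {n : ℕ} (j : Fin n) (F : (Fin n → ℂ) → ℂ) : (Fin n → ℂ) → ℂ :=
  fun z => deriv (fun w : ℂ => F (Function.update z j w)) (z j)

/-- `Df = ∂^n (z_1 ⋯ z_n f) / ∂z_1 ⋯ ∂z_n`; on power series, `∑ a_k z^k` is sent to
`∑ (k_1 + 1) ⋯ (k_n + 1) a_k z^k`. -/
noncomputable def diffD {n : ℕ} (f : (Fin n → ℂ) → ℂ) : (Fin n → ℂ) → ℂ :=
  (List.finRange n).foldr partialDeriv (fun z => (∏ j, z j) * f z)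

/-- The norm of `L_p(ω)`: the `p`-th root of the integral of
`|f(z)|^p ∏ ω_j(1-|z_j|) / (1-|z_j|^2)^2` over `U^n`. -/
noncomputable def lNorm {n : ℕ} (p : ℝ) (ω : Fin n → ℝ → ℝ) (f : (Fin n → ℂ) → ℂ) : ENNReal :=
  (∫⁻ z in polydisc n, ‖f z‖ₑ ^ p *
    ENNReal.ofReal (∏ j, ω j (1 - ‖z j‖) / (1 - ‖z j‖ ^ 2) ^ 2)) ^ (1 / p)

/-- Membership in `L_p(ω)`. -/
def MemL {n : ℕ} (p : ℝ) (ω : Fin n → ℝ → ℝ) (f : (Fin n → ℂ) → ℂ) : Prop :=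
  AEStronglyMeasurable f (volume.restrict (polydisc n)) ∧ lNorm p ω f < ⊤

/-- The norm of `B_p(ω)`: the `p`-th root of the integral of
`|Df(z)|^p ∏ ω_j(1-|z_j|) / (1-|z_j|^2)^(2-p)` over `U^n`. -/
noncomputable def bNorm {n : ℕ} (p : ℝ) (ω : Fin n → ℝ → ℝ) (f : (Fin n → ℂ) → ℂ) : ENNReal :=
  (∫⁻ z in polydisc n, ‖diffD f z‖ₑ ^ p *
    ENNReal.ofReal (∏ j, ω j (1 - ‖z j‖) / (1 - ‖z j‖ ^ 2) ^ (2 - p))) ^ (1 / p)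

/-- Membership in the holomorphic Besov space `B_p(ω)`. -/
def MemB {n : ℕ} (p : ℝ) (ω : Fin n → ℝ → ℝ) (f : (Fin n → ℂ) → ℂ) : Prop :=
  DifferentiableOn ℂ f (polydisc n) ∧ bNorm p ω f < ⊤

/-- The integrand `(1-|ζ|^2)^α / |1 - z conj(ζ)|^(4+2α) f(ζ) g(ζ)` of the Berezin-type operator. -/
noncomputable def berezinIntegrand {n : ℕ} (α : Fin n → ℝ) (g f : (Fin n → ℂ) → ℂ)
    (z ζ : Fin n → ℂ) : ℂ :=
  ((∏ j, (1 - ‖ζ j‖ ^ 2) ^ α j / ‖1 - z j * (starRingEnd ℂ) (ζ j)‖ ^ (4 + 2 * α j) : ℝ) : ℂ)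
    * f ζ * g ζ

/-- The Berezin-type operator `B^α_g`. -/
noncomputable def berezin {n : ℕ} (α : Fin n → ℝ) (g f : (Fin n → ℂ) → ℂ) (z : Fin n → ℂ) : ℂ :=
  (((∏ j, (α j + 1)) / Real.pi ^ n * ∏ j, (1 - ‖z j‖ ^ 2) ^ (α j + 2) : ℝ) : ℂ)
    * ∫ ζ in polydisc n, berezinIntegrand α g f z ζ

end WeightedBesov

/-!
Write `d(x) = 1 - |x|^2`, and let `a_j` be the index `alphaIndex (m j) (q j)` and `b_j > 1` the
negative of the upper exponent. The hypotheses on the weights say that `ω_j` lies between the powers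
`a_j` and `b_j` (`IsClassS.exists_isPowerBetween`), so the classical Forelli–Rudin estimate holds
with the weight `ω_j` in it (`IsPowerBetween.exists_lintegral_le`).

The heart of the proof is a substitute for Hölder's inequality when `p < 1`. If `F` is holomorphic
on the polydisc and `κ(x) = ∏ d(x_j)^(A_j) / |1 - z_j conj(x_j)|^(B_j)`, then
`(∫ |F| κ)^p ≤ C ∫ |F|^p κ^p ∏ d(x_j)^(2p - 2)` (`exists_rpow_lintegral_mul_polyKernel_le`). Indeed
the sub-mean value property of `|F|^p` and the slow variation of `κ` on hyperbolic discs bound the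
supremum of `(|F| κ ∏ d^2)^p` by its integral against the invariant measure `∏ d^(-2)`
(`enorm_rpow_mul_polyKernel_le`), and it remains to split `h = h^p * h^(1-p)`
(`rpow_lintegral_mul_le`). Integrating against the weight and exchanging the integrals, one gets
from the weighted Forelli–Rudin estimate the basic inequality
`exists_lintegral_rpow_mul_polyWeight_le`.

It is applied twice. Applied to `F = f` and the kernel of `B^α_g`, it bounds `B^α_g f` by the norm
of `f` in `L_p(ω)`; the requirement on the exponents is precisely `α_j > a_j / p - 2`. Applied to
`F = Df` and a kernel with large exponents, it bounds the norm of `f` in `L_p(ω)` by the norm in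
`B_p(ω)`, since `|f|` is dominated by the integral of `|Df|` against such a kernel
(`enorm_le_lintegral_diffD_mul_polyKernel`): in one variable `f(z)` is the average of
`Df` over the segment `[0, z]`, and the several variables are treated one after the other. Only the
modulus of `f` enters, so antiholomorphic functions are covered as well.
-/

namespace WeightedBesov

open Filter Topology Metric

/-! ### Holomorphic functions of several variables -/

/-- The Cauchy estimate for the Fréchet derivative; the factor `2` comes from applying the
one-variable estimate on circles of radius `r / 2` inside the open ball. -/
theorem norm_fderiv_le_of_forall_norm_le {E : Type*} [NormedAddCommGroup E] [NormedSpace ℂ E]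
    {F : E → ℂ} {z : E} {r B : ℝ} (hr : 0 < r) (hF : DifferentiableOn ℂ F (ball z r))
    (hB : ∀ y ∈ ball z r, ‖F y‖ ≤ B) : ‖fderiv ℂ F z‖ ≤ 2 * B / r := by
  have hz : DifferentiableAt ℂ F z := hF.differentiableAt (ball_mem_nhds z hr)
  have hB0 : 0 ≤ B := (norm_nonneg _).trans (hB z (mem_ball_self hr))
  refine ContinuousLinearMap.opNorm_le_bound _ (by positivity) fun v => ?_
  rcases eq_or_ne v 0 with rfl | hv
  · simp
  have hv0 : 0 < ‖v‖ := norm_pos_iff.2 hv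
  set R : ℝ := r / (2 * ‖v‖) with hR
  have hR0 : 0 < R := by positivity
  have hmem : ∀ w ∈ closedBall (0 : ℂ) R, z + w • v ∈ ball z r := by
    intro w hw
    rw [mem_closedBall_zero_iff] at hw
    rw [mem_ball_iff_norm, add_sub_cancel_left, norm_smul]
    calc ‖w‖ * ‖v‖ ≤ R * ‖v‖ := by gcongr
      _ = r / 2 := by rw [hR]; field_simp
      _ < r := by linarith
  have hd : ∀ w ∈ closedBall (0 : ℂ) R, DifferentiableAt ℂ (fun w : ℂ => F (z + w • v)) w := by
    intro w hw
    have h1 := hF.differentiableAt (isOpen_ball.mem_nhds (hmem w hw))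
    exact DifferentiableAt.comp (f := fun w : ℂ => z + w • v) (g := F) w h1 (by fun_prop)
  have hderiv : deriv (fun w : ℂ => F (z + w • v)) 0 = fderiv ℂ F z v := by
    have h1 : HasFDerivAt F (fderiv ℂ F z) (z + (0 : ℂ) • v) := by simpa using hz.hasFDerivAt
    have h2 : HasDerivAt (fun w : ℂ => z + w • v) v 0 := by
      simpa using ((hasDerivAt_id (0 : ℂ)).smul_const v).const_add z
    exact (h1.comp_hasDerivAt 0 h2).deriv
  have key := Complex.norm_deriv_le_of_forall_mem_sphere_norm_le (c := 0) (R := R) (C := B)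
    (f := fun w : ℂ => F (z + w • v)) hR0
    (DifferentiableOn.diffContOnCl fun w hw =>
      (hd w (closure_ball_subset_closedBall hw)).differentiableWithinAt)
    (fun w hw => hB _ (hmem w (sphere_subset_closedBall hw)))
  rw [hderiv] at key
  refine key.trans (le_of_eq ?_)
  rw [hR]; field_simp

/-- A complex directional derivative of a holomorphic function on an open subset of a normed space
is holomorphic: differentiate Cauchy's formula for the derivative under the integral sign. -/
theorem differentiableOn_fderiv_apply {E : Type*} [NormedAddCommGroup E] [NormedSpace ℂ E]
    [MeasurableSpace E] [BorelSpace E] [FiniteDimensional ℂ E]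
    {F : E → ℂ} {U : Set E} (hU : IsOpen U)
    (hF : DifferentiableOn ℂ F U) (v : E) :
    DifferentiableOn ℂ (fun z => fderiv ℂ F z v) U := by
  have : ProperSpace E := FiniteDimensional.proper ℂ E
  have : FiniteDimensional ℂ (E →L[ℂ] ℂ) := inferInstance
  have : ProperSpace (E →L[ℂ] ℂ) := FiniteDimensional.proper ℂ _
  intro z₀ hz₀
  apply DifferentiableAt.differentiableWithinAt
  have hev : ∀ᶠ y in 𝓝 z₀, y ∈ U ∧ ‖F y‖ ≤ ‖F z₀‖ + 1 := by
    refine Filter.Eventually.and (hU.mem_nhds hz₀) ?_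
    have := (hF.differentiableAt (hU.mem_nhds hz₀)).continuousAt.norm
    exact (this.eventually (gt_mem_nhds (lt_add_one _))).mono fun y hy => hy.le
  obtain ⟨r, hr, hball⟩ := Metric.eventually_nhds_iff_ball.1 hev
  set B := ‖F z₀‖ + 1 with hB
  set ε : ℝ := r / (3 * (‖v‖ + 1)) with hε
  have hε0 : 0 < ε := by positivity
  have hεv : ε * ‖v‖ ≤ r / 3 := by
    rw [hε, div_mul_eq_mul_div, div_le_div_iff₀ (by positivity) (by positivity)]
    nlinarith [norm_nonneg v]
  have hmem : ∀ y ∈ ball z₀ (r / 3), ∀ w ∈ closedBall (0 : ℂ) ε,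
      ball (y + w • v) (r / 3) ⊆ ball z₀ r := by
    intro y hy w hw u hu
    rw [mem_closedBall_zero_iff] at hw
    rw [mem_ball_iff_norm] at *
    have h1 : ‖w • v‖ ≤ r / 3 := by
      rw [norm_smul]; exact (mul_le_mul_of_nonneg_right hw (norm_nonneg v)).trans hεv
    calc ‖u - z₀‖ = ‖(u - (y + w • v)) + (y - z₀) + w • v‖ := by congr 1; abel
      _ ≤ ‖u - (y + w • v)‖ + ‖y - z₀‖ + ‖w • v‖ := norm_add₃_le
      _ < r := by linarith
  have hmem' : ∀ y ∈ ball z₀ (r / 3), ∀ w ∈ closedBall (0 : ℂ) ε, y + w • v ∈ ball z₀ r :=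
    fun y hy w hw => hmem y hy w hw (mem_ball_self (by positivity))
  have hdiff : ∀ y ∈ ball z₀ r, DifferentiableAt ℂ F y := fun y hy =>
    hF.differentiableAt (hU.mem_nhds (hball y hy).1)
  have hformula : ∀ y ∈ ball z₀ (r / 3), fderiv ℂ F y v =
      (2 * ↑Real.pi * Complex.I : ℂ)⁻¹ • ∮ w in C(0, ε), ((w - 0) ^ 2)⁻¹ • F (y + w • v) := by
    intro y hy
    have hy0 : y ∈ ball z₀ r := ball_subset_ball (by linarith) hy
    have hderiv : deriv (fun w : ℂ => F (y + w • v)) 0 = fderiv ℂ F y v := by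
      have h1 : HasFDerivAt F (fderiv ℂ F y) (y + (0 : ℂ) • v) := by
        simpa using (hdiff y hy0).hasFDerivAt
      have h2 : HasDerivAt (fun w : ℂ => y + w • v) v 0 := by
        simpa using ((hasDerivAt_id (0 : ℂ)).smul_const v).const_add y
      exact (h1.comp_hasDerivAt 0 h2).deriv
    have hO : IsOpen ((fun w : ℂ => y + w • v) ⁻¹' ball z₀ r) :=
      isOpen_ball.preimage (by fun_prop)
    rw [← hderiv, Complex.two_pi_I_inv_smul_circleIntegral_sub_sq_inv_smul_of_differentiable hO
      (fun w hw => hmem' y hy w hw) _ (mem_ball_self hε0)]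
    intro w hw
    exact (DifferentiableAt.comp (f := fun w : ℂ => y + w • v) (g := F) w (hdiff _ hw)
      (by fun_prop)).differentiableWithinAt
  have hs : ball z₀ (r / 3) ∈ 𝓝 z₀ := ball_mem_nhds _ (by positivity)
  have hcirc : ∀ θ : ℝ, circleMap 0 ε θ ∈ closedBall (0 : ℂ) ε := fun θ =>
    sphere_subset_closedBall (circleMap_mem_sphere _ hε0.le _)
  have hcont : ∀ y ∈ ball z₀ (r / 3), Continuous fun θ : ℝ =>
      deriv (circleMap 0 ε) θ • ((circleMap 0 ε θ - 0) ^ 2)⁻¹ • F (y + circleMap 0 ε θ • v) := by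
    intro y hy
    have hF' : Continuous fun θ : ℝ => F (y + circleMap 0 ε θ • v) := by
      have : ContinuousOn F (ball z₀ r) := fun u hu => (hdiff u hu).continuousAt.continuousWithinAt
      exact this.comp_continuous (by fun_prop) fun θ => hmem' y hy _ (hcirc θ)
    have h2 : Continuous fun θ : ℝ => ((circleMap 0 ε θ - 0) ^ 2)⁻¹ := by
      refine Continuous.inv₀ (by fun_prop) fun θ => ?_
      simp [circleMap_eq_center_iff, hε0.ne']
    have h3 : Continuous fun θ : ℝ => deriv (circleMap 0 ε) θ := by
      simp only [deriv_circleMap]; fun_prop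
    exact h3.smul (h2.smul hF')
  have hD := intervalIntegral.hasFDerivAt_integral_of_dominated_of_fderiv_le (𝕜 := ℂ)
    (μ := volume) (a := 0) (b := 2 * Real.pi) (x₀ := z₀)
    (F := fun y θ => deriv (circleMap 0 ε) θ • ((circleMap 0 ε θ - 0) ^ 2)⁻¹ •
      F (y + circleMap 0 ε θ • v))
    (F' := fun y θ => deriv (circleMap 0 ε) θ • ((circleMap 0 ε θ - 0) ^ 2)⁻¹ •
      fderiv ℂ F (y + circleMap 0 ε θ • v))
    (bound := fun _ => ε * ((ε ^ 2)⁻¹ * (2 * B / (r / 3)))) hs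
    (Filter.eventually_of_mem hs fun y hy => (hcont y hy).aestronglyMeasurable)
    ((hcont z₀ (mem_ball_self (by positivity))).intervalIntegrable _ _)
    ?_ ?_ intervalIntegrable_const ?_
  · have h1 : (fun z => fderiv ℂ F z v) =ᶠ[𝓝 z₀] fun y => (2 * ↑Real.pi * Complex.I : ℂ)⁻¹ •
        ∮ w in C(0, ε), ((w - 0) ^ 2)⁻¹ • F (y + w • v) :=
      Filter.eventually_of_mem hs hformula
    rw [h1.differentiableAt_iff]
    exact DifferentiableAt.fun_const_smul hD.differentiableAt _
  · have h1 : Measurable (fderiv ℂ F) := measurable_fderiv ℂ F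
    have h2 : Measurable fun θ : ℝ => fderiv ℂ F (z₀ + circleMap 0 ε θ • v) :=
      h1.comp (by fun_prop : Continuous fun θ : ℝ => z₀ + circleMap 0 ε θ • v).measurable
    have h3 : Continuous fun θ : ℝ => deriv (circleMap 0 ε) θ := by
      simp only [deriv_circleMap]; fun_prop
    have h4 : Continuous fun θ : ℝ => (circleMap 0 ε θ - 0) ^ 2 := by fun_prop
    exact h3.aestronglyMeasurable.smul
      (h4.measurable.inv.aestronglyMeasurable.smul h2.aestronglyMeasurable)
  · refine Filter.Eventually.of_forall fun θ _ y hy => ?_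
    rw [norm_smul, norm_smul]
    have h1 : ‖deriv (circleMap 0 ε) θ‖ = ε := by simp [deriv_circleMap, hε0.le]
    have h2 : ‖((circleMap 0 ε θ - 0) ^ 2)⁻¹‖ = (ε ^ 2)⁻¹ := by simp
    rw [h1, h2]
    gcongr
    refine norm_fderiv_le_of_forall_norm_le (by positivity) ?_ ?_
    · exact fun u hu => (hdiff u (hmem y hy _ (hcirc θ) hu)).differentiableWithinAt
    · exact fun u hu => (hball u (hmem y hy _ (hcirc θ) hu)).2
  · refine Filter.Eventually.of_forall fun θ _ y hy => ?_
    have h1 := (hdiff _ (hmem' y hy _ (hcirc θ))).hasFDerivAt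
    have h2 : HasFDerivAt (fun y : E => y + circleMap 0 ε θ • v) (ContinuousLinearMap.id ℂ E) y :=
      (hasFDerivAt_id y).add_const _
    exact ((h1.comp y h2).fun_const_smul _).fun_const_smul _

theorem isOpen_polydisc (n : ℕ) : IsOpen (polydisc n) := by
  have : polydisc n = ⋂ j, {z : Fin n → ℂ | ‖z j‖ < 1} := by ext; simp [polydisc]
  rw [this]
  exact isOpen_iInter_of_finite fun j => isOpen_lt (by fun_prop) continuous_const

theorem update_mem_polydisc {n : ℕ} {z : Fin n → ℂ} (hz : z ∈ polydisc n) (j : Fin n) {w : ℂ}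
    (hw : ‖w‖ < 1) : Function.update z j w ∈ polydisc n := by
  intro i
  rcases eq_or_ne i j with rfl | hij
  · simpa using hw
  · simpa [Function.update_of_ne hij] using hz i

theorem differentiable_update {n : ℕ} (z : Fin n → ℂ) (j : Fin n) :
    Differentiable ℂ fun w : ℂ => Function.update z j w := fun w =>
  (hasFDerivAt_update z w).differentiableAt

theorem differentiableOn_comp_update {n : ℕ} {F : (Fin n → ℂ) → ℂ}
    (hF : DifferentiableOn ℂ F (polydisc n)) {z : Fin n → ℂ} (hz : z ∈ polydisc n) (j : Fin n) :
    DifferentiableOn ℂ (fun w => F (Function.update z j w)) (ball 0 1) :=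
  hF.comp (differentiable_update z j).differentiableOn fun w hw =>
    update_mem_polydisc hz j (by simpa using hw)

theorem partialDeriv_eq_fderiv {n : ℕ} (j : Fin n) {F : (Fin n → ℂ) → ℂ} {z : Fin n → ℂ}
    (hF : DifferentiableAt ℂ F z) : partialDeriv j F z = fderiv ℂ F z (Pi.single j 1) := by
  have h1 : HasFDerivAt F (fderiv ℂ F z) (Function.update z j (z j)) := by
    simpa using hF.hasFDerivAt
  exact (h1.comp_hasDerivAt (z j) (hasDerivAt_update z j (z j))).deriv

theorem differentiableOn_partialDeriv {n : ℕ} (j : Fin n) {F : (Fin n → ℂ) → ℂ}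
    (hF : DifferentiableOn ℂ F (polydisc n)) :
    DifferentiableOn ℂ (partialDeriv j F) (polydisc n) :=
  (differentiableOn_fderiv_apply (isOpen_polydisc n) hF (Pi.single j 1)).congr fun _ hz =>
    partialDeriv_eq_fderiv j (hF.differentiableAt ((isOpen_polydisc n).mem_nhds hz))

/-- The one-variable operator `k ↦ ∂(z_j k)/∂z_j`; the operator `diffD` is the composition of
these over all `j`. -/
noncomputable def coordD {n : ℕ} (j : Fin n) (k : (Fin n → ℂ) → ℂ) : (Fin n → ℂ) → ℂ :=
  partialDeriv j fun z => z j * k z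

theorem differentiableOn_coordD {n : ℕ} (j : Fin n) {F : (Fin n → ℂ) → ℂ}
    (hF : DifferentiableOn ℂ F (polydisc n)) :
    DifferentiableOn ℂ (coordD j F) (polydisc n) :=
  differentiableOn_partialDeriv j
    (DifferentiableOn.fun_mul (by fun_prop) hF)

theorem differentiableOn_foldr_coordD {n : ℕ} (L : List (Fin n)) {F : (Fin n → ℂ) → ℂ}
    (hF : DifferentiableOn ℂ F (polydisc n)) :
    DifferentiableOn ℂ (L.foldr coordD F) (polydisc n) := by
  induction L with
  | nil => exact hF
  | cons j L ih => exact differentiableOn_coordD j ih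

theorem foldr_partialDeriv_coord_mul {n : ℕ} {j : Fin n} {L : List (Fin n)} (hj : j ∉ L)
    (h : (Fin n → ℂ) → ℂ) :
    L.foldr partialDeriv (fun z => z j * h z) = fun z => z j * L.foldr partialDeriv h z := by
  induction L with
  | nil => rfl
  | cons i L ih =>
    rw [List.mem_cons, not_or] at hj
    rw [List.foldr_cons, ih hj.2]
    funext z
    simp only [partialDeriv, List.foldr_cons, Function.update_of_ne hj.1, deriv_const_mul_field]

theorem foldr_partialDeriv_prod_mul {n : ℕ} (f : (Fin n → ℂ) → ℂ) {L : List (Fin n)}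
    (hL : L.Nodup) :
    L.foldr partialDeriv (fun z => (L.map z).prod * f z) = L.foldr coordD f := by
  induction L with
  | nil => funext z; simp
  | cons j L ih =>
    rw [List.nodup_cons] at hL
    rw [List.foldr_cons, List.foldr_cons, ← ih hL.2, coordD, ← foldr_partialDeriv_coord_mul hL.1]
    simp only [List.map_cons, List.prod_cons, mul_assoc]

theorem diffD_eq_foldr_coordD {n : ℕ} (f : (Fin n → ℂ) → ℂ) :
    diffD f = (List.finRange n).foldr coordD f := by
  rw [← foldr_partialDeriv_prod_mul f (List.nodup_finRange n), diffD]
  simp only [← List.ofFn_eq_map, List.prod_ofFn]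

/-! ### Mean value inequalities in one variable -/

theorem lintegral_eq_lintegral_circleMap {f : ℂ → ENNReal} (hf : Measurable f) :
    ∫⁻ z, f z = ∫⁻ r in Set.Ioi (0 : ℝ), ∫⁻ θ in Set.Ioo (-Real.pi) Real.pi,
      ENNReal.ofReal r * f (circleMap 0 r θ) := by
  rw [← Complex.lintegral_comp_polarCoord_symm, polarCoord_target]
  have h1 : ∀ p : ℝ × ℝ, Complex.polarCoord.symm p = circleMap 0 p.1 p.2 := fun p => by
    rw [Complex.polarCoord_symm_apply, circleMap, zero_add, Complex.exp_mul_I]; push_cast; ring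
  simp only [h1, smul_eq_mul]
  have h2 : Continuous fun p : ℝ × ℝ => circleMap 0 p.1 p.2 := by unfold circleMap; fun_prop
  rw [Measure.volume_eq_prod, setLIntegral_prod]
  exact (Measurable.mul (by fun_prop) (hf.comp h2.measurable)).aemeasurable

theorem enorm_center_le_lintegral_circleMap {H : ℂ → ℂ} {c : ℂ} {R ρ : ℝ}
    (hH : DifferentiableOn ℂ H (ball c R)) (hρ : 0 < ρ) (hρR : ρ < R) :
    ENNReal.ofReal (2 * Real.pi) * ‖H c‖ₑ ≤
      ∫⁻ θ in Set.Ioo (-Real.pi) Real.pi, ‖H (c + circleMap 0 ρ θ)‖ₑ := by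
  have hd : DiffContOnCl ℂ H (ball c |ρ|) := by
    rw [abs_of_pos hρ]
    exact hH.diffContOnCl_ball (closedBall_subset_ball hρR)
  have h1 := hd.circleAverage
  rw [Real.circleAverage_eq_integral_add (-Real.pi)] at h1
  rw [intervalIntegral.integral_comp_add_right (fun θ => H (circleMap c ρ θ))] at h1
  have h2 : (∫ θ in (-Real.pi)..Real.pi, H (circleMap c ρ θ)) = (2 * Real.pi) • H c := by
    rw [← h1, smul_smul, mul_inv_cancel₀ (by positivity), one_smul]
    congr 1 <;> ring
  have h3 : ENNReal.ofReal (2 * Real.pi) * ‖H c‖ₑ =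
      ‖∫ θ in (-Real.pi)..Real.pi, H (circleMap c ρ θ)‖ₑ := by
    rw [h2, enorm_smul, Real.enorm_of_nonneg (by positivity)]
  rw [h3, intervalIntegral.integral_of_le (by linarith [Real.pi_pos]), integral_Ioc_eq_integral_Ioo]
  refine (enorm_integral_le_lintegral_enorm _).trans (le_of_eq ?_)
  simp [circleMap]

open scoped Classical in
theorem measurable_indicator_of_continuousOn {X : Type*} [TopologicalSpace X] [MeasurableSpace X]
    [OpensMeasurableSpace X] {s : Set X} (hs : MeasurableSet s) {f : X → ENNReal}
    (hf : ContinuousOn f s) : Measurable (s.indicator f) := by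
  rw [← Set.piecewise_eq_indicator]
  exact hf.measurable_piecewise continuousOn_const hs

theorem enorm_center_mul_area_le_lintegral {H : ℂ → ℂ} {c : ℂ} {R : ℝ} (hR : 0 < R)
    (hH : DifferentiableOn ℂ H (ball c R)) :
    ‖H c‖ₑ * ENNReal.ofReal (Real.pi * R ^ 2) ≤ ∫⁻ z in ball c R, ‖H z‖ₑ := by
  set u : ℂ → ENNReal := (ball c R).indicator fun z => ‖H z‖ₑ with hu
  have hum : Measurable u := measurable_indicator_of_continuousOn measurableSet_ball
    hH.continuousOn.enorm
  rw [← lintegral_indicator measurableSet_ball, ← lintegral_add_left_eq_self _ c,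
    lintegral_eq_lintegral_circleMap (f := fun z => u (c + z)) (hum.comp (by fun_prop))]
  have hsub : Set.Ioo (0 : ℝ) R ⊆ Set.Ioi 0 := fun x hx => hx.1
  refine le_trans ?_ (lintegral_mono_set hsub)
  have hint : ∫⁻ ρ in Set.Ioo (0 : ℝ) R, ENNReal.ofReal ρ = ENNReal.ofReal (R ^ 2 / 2) := by
    rw [← ofReal_integral_eq_lintegral_ofReal, ← integral_Ioc_eq_integral_Ioo,
      ← intervalIntegral.integral_of_le hR.le, integral_id]
    · simp
    · exact (continuous_id.integrableOn_Icc (a := 0) (b := R)).mono_set Set.Ioo_subset_Icc_self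
    · exact (ae_restrict_mem measurableSet_Ioo).mono fun x hx => hx.1.le
  calc ‖H c‖ₑ * ENNReal.ofReal (Real.pi * R ^ 2)
      = ENNReal.ofReal (R ^ 2 / 2) * (ENNReal.ofReal (2 * Real.pi) * ‖H c‖ₑ) := by
        rw [← mul_assoc, ← ENNReal.ofReal_mul (by positivity), mul_comm]; congr 2; ring
    _ = ∫⁻ ρ in Set.Ioo (0 : ℝ) R, ENNReal.ofReal ρ * (ENNReal.ofReal (2 * Real.pi) * ‖H c‖ₑ) := by
        rw [lintegral_mul_const _ (by fun_prop), hint]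
    _ ≤ _ := by
        refine setLIntegral_mono' measurableSet_Ioo fun ρ hρ => ?_
        rw [lintegral_const_mul' _ _ ENNReal.ofReal_ne_top]
        gcongr
        refine (enorm_center_le_lintegral_circleMap hH hρ.1 hρ.2).trans (le_of_eq ?_)
        refine lintegral_congr fun θ => ?_
        have : c + circleMap 0 ρ θ ∈ ball c R := by
          simp [circleMap, abs_of_pos hρ.1, hρ.2]
        rw [hu, Set.indicator_of_mem this]

/-- The constant in the mean value inequality for `|H|^p`. -/
noncomputable def subMeanConst (p : ℝ) : ℝ := 4 * (2 ^ (2 / p)) ^ (1 - p) / Real.pi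

theorem subMeanConst_pos (p : ℝ) : 0 < subMeanConst p := by
  unfold subMeanConst; positivity

/-- The sub-mean value property of `|H|^p`, `0 < p ≤ 1`, up to a constant. It follows from the case
`p = 1`, applied at a point where `(1 - |w - c| / δ) ^ (2 / p) * |H w|` is maximal. -/
theorem enorm_rpow_le_lintegral_ball {p : ℝ} (hp0 : 0 < p) (hp1 : p ≤ 1) {H : ℂ → ℂ} {c : ℂ}
    {δ : ℝ} (hδ : 0 < δ)
    (hH : DifferentiableOn ℂ H (closedBall c δ)) :
    ‖H c‖ₑ ^ p ≤ ENNReal.ofReal (subMeanConst p / δ ^ 2) * ∫⁻ z in ball c δ, ‖H z‖ₑ ^ p := by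
  rcases eq_or_ne (H c) 0 with h0 | h0
  · simp [h0, hp0]
  -- The exponent `2 / p` makes the `p`-th power of the factor a multiple of the area of the largest
  -- disc around `w` in `ball c δ`.
  set N : ℂ → ℝ := fun w => (1 - ‖w - c‖ / δ) ^ (2 / p) * ‖H w‖ with hN
  have hcont : ContinuousOn N (closedBall c δ) := by
    refine ContinuousOn.mul (Continuous.continuousOn ?_) (hH.continuousOn).norm
    exact Continuous.rpow_const (by fun_prop) fun _ => Or.inr (by positivity)
  obtain ⟨w₀, hw₀, hmax⟩ := (isCompact_closedBall c δ).exists_isMaxOn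
    ⟨c, mem_closedBall_self hδ.le⟩ hcont
  have hNc : N c = ‖H c‖ := by simp [hN]
  have hN0 : 0 < N w₀ := by
    have : N c ≤ N w₀ := hmax (mem_closedBall_self hδ.le)
    rw [hNc] at this
    exact (norm_pos_iff.2 h0).trans_le this
  have hle : ‖w₀ - c‖ ≤ δ := mem_closedBall_iff_norm.1 hw₀
  have hlt : ‖w₀ - c‖ < δ := by
    refine lt_of_le_of_ne hle fun h => ?_
    have : N w₀ = 0 := by simp [hN, h, hδ.ne', Real.zero_rpow (by positivity : 2 / p ≠ 0)]
    exact hN0.ne' this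
  set s : ℝ := (δ - ‖w₀ - c‖) / 2 with hs
  have hs0 : 0 < s := by rw [hs]; linarith
  have hx0 : 1 - ‖w₀ - c‖ / δ = 2 * s / δ := by rw [hs]; field_simp
  have hHw₀ : 0 < ‖H w₀‖ := by
    rw [hN] at hN0
    exact pos_of_mul_pos_right hN0 (by rw [hx0]; positivity)
  have hsub : ball w₀ s ⊆ ball c δ := by
    intro w hw
    rw [mem_ball_iff_norm] at *
    have : ‖w - c‖ ≤ ‖w - w₀‖ + ‖w₀ - c‖ := norm_sub_le_norm_sub_add_norm_sub _ _ _
    linarith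
  have hbd : ∀ w ∈ ball w₀ s, ‖H w‖ ≤ 2 ^ (2 / p) * ‖H w₀‖ := by
    intro w hw
    have h1 : N w ≤ N w₀ := hmax (ball_subset_closedBall (hsub hw))
    have h2 : s / δ ≤ 1 - ‖w - c‖ / δ := by
      rw [mem_ball_iff_norm] at hw
      have : ‖w - c‖ ≤ ‖w - w₀‖ + ‖w₀ - c‖ := norm_sub_le_norm_sub_add_norm_sub _ _ _
      rw [le_sub_iff_add_le, ← add_div, div_le_one hδ]; linarith
    have h3 : (s / δ) ^ (2 / p) * ‖H w‖ ≤ (s / δ) ^ (2 / p) * (2 ^ (2 / p) * ‖H w₀‖) := by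
      calc (s / δ) ^ (2 / p) * ‖H w‖ ≤ N w := by
            simp only [hN]; gcongr
        _ ≤ N w₀ := h1
        _ = _ := by
            simp only [hN, hx0]
            rw [mul_div_assoc, Real.mul_rpow (by norm_num) (by positivity)]; ring
    exact le_of_mul_le_mul_left h3 (by positivity)
  set I := ∫⁻ z in ball c δ, ‖H z‖ₑ ^ p with hI
  set X : ℝ := ‖H w₀‖ with hX
  have hmean : ENNReal.ofReal X * ENNReal.ofReal (Real.pi * s ^ 2) ≤
      ENNReal.ofReal ((2 ^ (2 / p) * X) ^ (1 - p)) * I := by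
    calc ENNReal.ofReal X * ENNReal.ofReal (Real.pi * s ^ 2)
        ≤ ∫⁻ z in ball w₀ s, ‖H z‖ₑ := by
          rw [hX, ofReal_norm]
          exact enorm_center_mul_area_le_lintegral hs0
            (hH.mono (hsub.trans ball_subset_closedBall))
      _ ≤ ∫⁻ z in ball w₀ s, ENNReal.ofReal ((2 ^ (2 / p) * X) ^ (1 - p)) * ‖H z‖ₑ ^ p := by
          refine setLIntegral_mono' measurableSet_ball fun w hw => ?_
          have h4 : ‖H w‖ = ‖H w‖ ^ (1 - p) * ‖H w‖ ^ p := by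
            rcases eq_or_ne (H w) 0 with h | h
            · simp [h, Real.zero_rpow hp0.ne']
            · rw [← Real.rpow_add (norm_pos_iff.2 h)]; simp
          rw [← ofReal_norm, ENNReal.ofReal_rpow_of_nonneg (norm_nonneg _) hp0.le,
            ← ENNReal.ofReal_mul (by positivity)]
          refine ENNReal.ofReal_le_ofReal ?_
          calc ‖H w‖ = ‖H w‖ ^ (1 - p) * ‖H w‖ ^ p := h4
            _ ≤ _ := mul_le_mul_of_nonneg_right (Real.rpow_le_rpow (norm_nonneg _) (hbd w hw)
                (by linarith)) (by positivity)
      _ ≤ _ := by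
          rw [lintegral_const_mul' _ _ ENNReal.ofReal_ne_top]
          gcongr
          exact lintegral_mono_set hsub
  have hfinal : ENNReal.ofReal (X ^ p) ≤
      ENNReal.ofReal ((2 ^ (2 / p)) ^ (1 - p) / (Real.pi * s ^ 2)) * I := by
    have h5 := mul_le_mul_right hmean (ENNReal.ofReal (X ^ (p - 1) / (Real.pi * s ^ 2)))
    rw [← ENNReal.ofReal_mul (by positivity), ← ENNReal.ofReal_mul (by positivity),
      ← mul_assoc (ENNReal.ofReal _) (ENNReal.ofReal _) I,
      ← ENNReal.ofReal_mul (by positivity)] at h5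
    convert h5 using 2
    · have : X ^ p = X ^ (p - 1) * X := by rw [← Real.rpow_add_one hHw₀.ne']; simp
      rw [this]; field_simp
    · congr 1
      rw [Real.mul_rpow (by positivity) hHw₀.le]
      have : X ^ (p - 1) * X ^ (1 - p) = 1 := by rw [← Real.rpow_add hHw₀]; simp
      field_simp
      linear_combination -this
  have hcw : ‖H c‖ ^ p ≤ (2 * s / δ) ^ 2 * X ^ p := by
    have h6 : ‖H c‖ ≤ (2 * s / δ) ^ (2 / p) * X := by
      rw [← hNc, hX, ← hx0]
      exact hmax (mem_closedBall_self hδ.le)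
    calc ‖H c‖ ^ p ≤ ((2 * s / δ) ^ (2 / p) * X) ^ p := by gcongr
      _ = _ := by
        rw [Real.mul_rpow (by positivity) hHw₀.le, ← Real.rpow_mul (by positivity),
          div_mul_cancel₀ _ hp0.ne']
        norm_num
  calc ‖H c‖ₑ ^ p = ENNReal.ofReal (‖H c‖ ^ p) := by
        rw [← ofReal_norm, ENNReal.ofReal_rpow_of_nonneg (norm_nonneg _) hp0.le]
    _ ≤ ENNReal.ofReal ((2 * s / δ) ^ 2) * ENNReal.ofReal (X ^ p) := by
        rw [← ENNReal.ofReal_mul (by positivity)]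
        exact ENNReal.ofReal_le_ofReal hcw
    _ ≤ ENNReal.ofReal ((2 * s / δ) ^ 2) *
        (ENNReal.ofReal ((2 ^ (2 / p)) ^ (1 - p) / (Real.pi * s ^ 2)) * I) := by gcongr
    _ = _ := by
        rw [← mul_assoc, ← ENNReal.ofReal_mul (by positivity)]
        congr 2
        unfold subMeanConst
        field_simp
        ring

/-! ### Kernels on the unit disc -/

/-- The defining function `1 - |z|^2` of the unit disc. -/
noncomputable def defect (z : ℂ) : ℝ := 1 - ‖z‖ ^ 2

/-- The kernel `(1 - |x|^2)^A / |1 - z conj(x)|^B` on the unit disc. -/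
noncomputable def discKernel (A B : ℝ) (z x : ℂ) : ℝ :=
  defect x ^ A / ‖1 - z * (starRingEnd ℂ) x‖ ^ B

theorem defect_pos {z : ℂ} (hz : ‖z‖ < 1) : 0 < defect z := by
  unfold defect; nlinarith [norm_nonneg z]

theorem defect_le {z : ℂ} (hz : ‖z‖ < 1) : defect z ≤ 2 * (1 - ‖z‖) := by
  unfold defect; nlinarith [norm_nonneg z]

theorem le_defect {z : ℂ} (hz : ‖z‖ < 1) : 1 - ‖z‖ ≤ defect z := by
  unfold defect; nlinarith [norm_nonneg z]

theorem one_sub_norm_le_norm_one_sub_mul {z x : ℂ} (hz : ‖z‖ < 1) :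
    1 - ‖x‖ ≤ ‖1 - z * (starRingEnd ℂ) x‖ := by
  have h1 : ‖(1 : ℂ)‖ - ‖z * (starRingEnd ℂ) x‖ ≤ ‖1 - z * (starRingEnd ℂ) x‖ :=
    norm_sub_norm_le _ _
  rw [norm_one, norm_mul, RCLike.norm_conj] at h1
  nlinarith [norm_nonneg x]

theorem norm_one_sub_mul_pos {z x : ℂ} (hz : ‖z‖ < 1) (hx : ‖x‖ < 1) :
    0 < ‖1 - z * (starRingEnd ℂ) x‖ :=
  (by linarith : 0 < 1 - ‖x‖).trans_le (one_sub_norm_le_norm_one_sub_mul hz)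

theorem discKernel_nonneg (A B : ℝ) (z : ℂ) {x : ℂ} (hx : ‖x‖ < 1) : 0 ≤ discKernel A B z x := by
  have := defect_pos hx
  unfold discKernel; positivity

theorem discKernel_pos (A B : ℝ) {z x : ℂ} (hz : ‖z‖ < 1) (hx : ‖x‖ < 1) :
    0 < discKernel A B z x := by
  have := defect_pos hx
  have := norm_one_sub_mul_pos hz hx
  unfold discKernel; positivity

theorem measurable_discKernel (A B : ℝ) : Measurable fun q : ℂ × ℂ => discKernel A B q.1 q.2 := by
  unfold discKernel defect
  have h : Continuous fun q : ℂ × ℂ => ‖1 - q.1 * (starRingEnd ℂ) q.2‖ := by fun_prop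
  exact Measurable.div (Measurable.pow_const (by fun_prop) _) (h.measurable.pow_const _)

theorem measurable_discKernel_right (A B : ℝ) (z : ℂ) : Measurable (discKernel A B z) :=
  (measurable_discKernel A B).comp (f := fun x => (z, x)) (by fun_prop)

theorem discKernel_mul_defect_rpow (A B E : ℝ) (z : ℂ) {x : ℂ} (hx : ‖x‖ < 1) :
    discKernel A B z x * defect x ^ E = discKernel (A + E) B z x := by
  rw [discKernel, discKernel, Real.rpow_add (defect_pos hx)]; ring

theorem discKernel_rpow (A B p : ℝ) (z : ℂ) {x : ℂ} (hx : ‖x‖ < 1) :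
    discKernel A B z x ^ p = discKernel (p * A) (p * B) z x := by
  have := defect_pos hx
  rw [discKernel, discKernel, Real.div_rpow (by positivity) (by positivity),
    ← Real.rpow_mul this.le, ← Real.rpow_mul (norm_nonneg _), mul_comm A, mul_comm B]

theorem rpow_le_four_rpow_abs_mul {x y : ℝ} (hx : 0 < x) (hy : 0 < y) (hxy : x ≤ 4 * y)
    (hyx : y ≤ 4 * x) (e : ℝ) : x ^ e ≤ 4 ^ |e| * y ^ e := by
  rcases le_total 0 e with he | he
  · rw [abs_of_nonneg he, ← Real.mul_rpow (by norm_num) hy.le]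
    exact Real.rpow_le_rpow hx.le hxy he
  · rw [abs_of_nonpos he, Real.rpow_neg (by norm_num), ← Real.inv_rpow (by norm_num),
      ← Real.mul_rpow (by norm_num) hy.le]
    exact Real.rpow_le_rpow_of_nonpos (by positivity) (by linarith) he

/-- The kernels are slowly varying on discs whose radius is half the distance to the circle. -/
theorem discKernel_le_of_mem_ball (A B : ℝ) {z x y : ℂ} (hz : ‖z‖ < 1) (hx : ‖x‖ < 1)
    (hy : y ∈ ball x ((1 - ‖x‖) / 2)) :
    discKernel A B z x ≤ 4 ^ |A| * 4 ^ |B| * discKernel A B z y := by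
  rw [mem_ball_iff_norm] at hy
  have h1 : |‖y‖ - ‖x‖| ≤ ‖y - x‖ := abs_norm_sub_norm_le _ _
  rw [abs_le] at h1
  have hy1 : ‖y‖ < 1 := by linarith
  have h2 : ‖(1 - z * (starRingEnd ℂ) y) - (1 - z * (starRingEnd ℂ) x)‖ ≤ ‖y - x‖ := by
    have : (1 - z * (starRingEnd ℂ) y) - (1 - z * (starRingEnd ℂ) x)
        = z * (starRingEnd ℂ) (x - y) := by rw [map_sub]; ring
    rw [this, norm_mul, RCLike.norm_conj, norm_sub_rev]
    nlinarith [norm_nonneg (y - x)]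
  have h3 := (abs_norm_sub_norm_le _ _).trans h2
  rw [abs_le] at h3
  have h4 := one_sub_norm_le_norm_one_sub_mul (x := x) hz
  have h5 := defect_le hx
  have h6 := defect_le hy1
  have h7 := le_defect hx
  have h8 := le_defect hy1
  have hd : defect x ^ A ≤ 4 ^ |A| * defect y ^ A :=
    rpow_le_four_rpow_abs_mul (defect_pos hx) (defect_pos hy1) (by linarith) (by linarith) A
  have hn := rpow_le_four_rpow_abs_mul (norm_one_sub_mul_pos hz hx) (norm_one_sub_mul_pos hz hy1)
    (by linarith) (by linarith) (-B)
  rw [Real.rpow_neg (norm_nonneg _), Real.rpow_neg (norm_nonneg _), abs_neg] at hn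
  have hdx := defect_pos hx
  have hdy := defect_pos hy1
  calc discKernel A B z x = defect x ^ A * (‖1 - z * (starRingEnd ℂ) x‖ ^ B)⁻¹ := div_eq_mul_inv _ _
    _ ≤ (4 ^ |A| * defect y ^ A) * (4 ^ |B| * (‖1 - z * (starRingEnd ℂ) y‖ ^ B)⁻¹) := by gcongr
    _ = _ := by rw [discKernel]; ring

theorem ball_subset_unit_ball {x : ℂ} (hx : ‖x‖ < 1) :
    closedBall x ((1 - ‖x‖) / 2) ⊆ ball 0 1 := by
  intro y hy
  rw [mem_closedBall_iff_norm] at hy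
  have : ‖y‖ ≤ ‖y - x‖ + ‖x‖ := by simpa using norm_sub_le_norm_sub_add_norm_sub y x 0
  rw [mem_ball_zero_iff]
  linarith

/-- The constant in `enorm_rpow_mul_discKernel_le`. -/
noncomputable def weightedSubMeanConst (p A B : ℝ) : ℝ :=
  16 * subMeanConst p * (4 ^ |A - 2| * 4 ^ |B|)

theorem weightedSubMeanConst_pos (p A B : ℝ) : 0 < weightedSubMeanConst p A B := by
  have := subMeanConst_pos p
  unfold weightedSubMeanConst; positivity

/-- A weighted sub-mean value property of `|H|^p` with respect to the Möbius invariant measure of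
the disc. -/
theorem enorm_rpow_mul_discKernel_le {p : ℝ} (hp0 : 0 < p) (hp1 : p ≤ 1) (A B : ℝ) {z x : ℂ}
    (hz : ‖z‖ < 1) (hx : ‖x‖ < 1) {H : ℂ → ℂ} (hH : DifferentiableOn ℂ H (ball 0 1)) :
    ‖H x‖ₑ ^ p * ENNReal.ofReal (discKernel A B z x) ≤
      ∫⁻ y in ball (0 : ℂ) 1, ‖H y‖ₑ ^ p *
        ENNReal.ofReal (weightedSubMeanConst p A B * discKernel (A - 2) B z y) := by
  have hS := subMeanConst_pos p
  set δ : ℝ := (1 - ‖x‖) / 2 with hδ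
  have hδ0 : 0 < δ := by rw [hδ]; linarith
  have hsub := ball_subset_unit_ball hx
  have hK := discKernel_pos (A - 2) B hz hx
  have h1 : subMeanConst p / δ ^ 2 * discKernel A B z x ≤
      16 * subMeanConst p * discKernel (A - 2) B z x := by
    have h2 : discKernel A B z x = discKernel (A - 2) B z x * defect x ^ 2 := by
      rw [← Real.rpow_two, discKernel_mul_defect_rpow _ _ _ _ hx]; congr 1; ring
    have h3 : defect x ≤ 4 * δ := by have := defect_le hx; rw [hδ]; linarith
    have h4 : defect x ^ 2 ≤ (4 * δ) ^ 2 := by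
      have := defect_pos hx
      gcongr
    rw [h2, div_mul_eq_mul_div, div_le_iff₀ (by positivity)]
    calc subMeanConst p * (discKernel (A - 2) B z x * defect x ^ 2)
        ≤ subMeanConst p * (discKernel (A - 2) B z x * (4 * δ) ^ 2) := by gcongr
      _ = _ := by ring
  calc ‖H x‖ₑ ^ p * ENNReal.ofReal (discKernel A B z x)
      ≤ (ENNReal.ofReal (subMeanConst p / δ ^ 2) * ∫⁻ y in ball x δ, ‖H y‖ₑ ^ p) *
          ENNReal.ofReal (discKernel A B z x) := by
        gcongr
        exact enorm_rpow_le_lintegral_ball hp0 hp1 hδ0 (hH.mono hsub)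
    _ = ENNReal.ofReal (subMeanConst p / δ ^ 2 * discKernel A B z x) *
          ∫⁻ y in ball x δ, ‖H y‖ₑ ^ p := by
        rw [ENNReal.ofReal_mul (by positivity)]; ring
    _ ≤ ENNReal.ofReal (16 * subMeanConst p * discKernel (A - 2) B z x) *
          ∫⁻ y in ball x δ, ‖H y‖ₑ ^ p := by gcongr
    _ = ∫⁻ y in ball x δ, ‖H y‖ₑ ^ p *
          ENNReal.ofReal (16 * subMeanConst p * discKernel (A - 2) B z x) := by
        rw [mul_comm, lintegral_mul_const' _ _ ENNReal.ofReal_ne_top]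
    _ ≤ ∫⁻ y in ball x δ, ‖H y‖ₑ ^ p *
          ENNReal.ofReal (weightedSubMeanConst p A B * discKernel (A - 2) B z y) := by
        refine setLIntegral_mono' measurableSet_ball fun y hy => ?_
        refine mul_le_mul' le_rfl (ENNReal.ofReal_le_ofReal ?_)
        rw [weightedSubMeanConst, mul_assoc _ (_ * _) (discKernel _ _ _ _)]
        exact mul_le_mul_of_nonneg_left (discKernel_le_of_mem_ball _ _ hz hx hy) (by positivity)
    _ ≤ _ := lintegral_mono_set (ball_subset_closedBall.trans hsub)

/-- `k` is the average of the derivative of `w k(w)` over the segment `[0, z]`. -/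
theorem enorm_le_lintegral_deriv_id_mul {k : ℂ → ℂ} (hk : DifferentiableOn ℂ k (ball 0 1)) {z : ℂ}
    (hz : ‖z‖ < 1) :
    ‖k z‖ₑ ≤ ∫⁻ t in Set.Ioo (0 : ℝ) 1, ‖deriv (fun w => w * k w) (t * z)‖ₑ := by
  set G : ℂ → ℂ := deriv fun w => w * k w with hG
  have hmul : DifferentiableOn ℂ (fun w => w * k w) (ball 0 1) :=
    DifferentiableOn.fun_mul differentiableOn_id hk
  have hmem : ∀ t ∈ Set.Icc (0 : ℝ) 1, (t : ℂ) * z ∈ ball (0 : ℂ) 1 := by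
    intro t ht
    rw [mem_ball_zero_iff, norm_mul, Complex.norm_real, Real.norm_of_nonneg ht.1]
    nlinarith [ht.2, norm_nonneg z]
  have hint : k z = ∫ t in (0 : ℝ)..1, G (t * z) := by
    rcases eq_or_ne z 0 with rfl | hz0
    · have : HasDerivAt (fun w => w * k w) (1 * k 0 + 0 * deriv k 0) 0 :=
        (hasDerivAt_id (0 : ℂ)).mul
          (hk.differentiableAt (ball_mem_nhds _ one_pos)).hasDerivAt
      have h0 : G 0 = k 0 := by rw [hG, this.deriv]; ring
      simp [h0]
    · have hcont : ContinuousOn (fun t : ℝ => z * G (t * z)) (Set.uIcc 0 1) := by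
        rw [Set.uIcc_of_le zero_le_one]
        refine continuousOn_const.mul ((hmul.deriv isOpen_ball).continuousOn.comp ?_ hmem)
        fun_prop
      have hder : ∀ t ∈ Set.uIcc (0 : ℝ) 1,
          HasDerivAt (fun t : ℝ => (t : ℂ) * z * k (t * z)) (z * G (t * z)) t := by
        intro t ht
        rw [Set.uIcc_of_le zero_le_one] at ht
        have h1 : HasDerivAt (fun w => w * k w) (G (t * z)) (t * z) :=
          (hmul.differentiableAt (isOpen_ball.mem_nhds (hmem t ht))).hasDerivAt
        have h2 : HasDerivAt (fun t : ℝ => (t : ℂ) * z) z t := by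
          simpa using (Complex.ofRealCLM.hasDerivAt (x := t)).mul_const z
        have h3 := HasDerivAt.scomp t h1 h2
        simpa [smul_eq_mul, Function.comp_def] using h3
      have := intervalIntegral.integral_eq_sub_of_hasDerivAt hder hcont.intervalIntegrable
      rw [intervalIntegral.integral_const_mul] at this
      simp only [Complex.ofReal_one, one_mul, Complex.ofReal_zero, zero_mul, sub_zero] at this
      exact (mul_left_cancel₀ hz0 this).symm
  rw [hint, intervalIntegral.integral_of_le zero_le_one, integral_Ioc_eq_integral_Ioo]
  exact enorm_integral_le_lintegral_enorm _

/-- The integral over the points `t z` of the segment `[0, z]` at bounded hyperbolic distance from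
`x`. These form a set of length `O(1 - |x|)`, on which the integrand is `O((1 - |x|)^(-2))`; if
there are any, then `|1 - z conj(x)| = O(1 - |x|)`, so the factor with exponent `N` is free. -/
theorem lintegral_segment_le {S N : ℝ} (hS : 0 < S) (hN : 0 ≤ N) {z x : ℂ} (hz : ‖z‖ < 1)
    (hx : ‖x‖ < 1) :
    ∫⁻ t in Set.Ioo (0 : ℝ) 1, {t : ℝ | ‖x - t * z‖ < (1 - t * ‖z‖) / 2}.indicator
      (fun t => ENNReal.ofReal (S / ((1 - t * ‖z‖) / 2) ^ 2)) t ≤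
      ENNReal.ofReal (144 * 5 ^ N * S * discKernel (N - 1) N z x) := by
  set T : Set ℝ := {t : ℝ | ‖x - t * z‖ < (1 - t * ‖z‖) / 2} with hT
  have hTm : MeasurableSet T := (isOpen_lt (by fun_prop) (by fun_prop)).measurableSet
  rw [lintegral_indicator hTm, Measure.restrict_restrict hTm]
  have hρ : 0 < 1 - ‖x‖ := by linarith
  have hnz : ∀ t ∈ T ∩ Set.Ioo 0 1, ‖(t : ℂ) * z‖ = t * ‖z‖ := fun t ht => by
    rw [norm_mul, Complex.norm_real, Real.norm_of_nonneg ht.2.1.le]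
  have hlow : ∀ t ∈ T ∩ Set.Ioo 0 1, (1 - ‖x‖) / 3 ≤ (1 - t * ‖z‖) / 2 := by
    intro t ht
    have h1 : ‖x - t * z‖ < (1 - t * ‖z‖) / 2 := ht.1
    have h2 : ‖(t : ℂ) * z‖ - ‖x‖ ≤ ‖x - t * z‖ := by
      rw [norm_sub_rev]; exact norm_sub_norm_le _ _
    rw [hnz t ht] at h2
    linarith
  have hup : ∀ t ∈ T ∩ Set.Ioo 0 1, (1 - t * ‖z‖) / 2 ≤ 1 - ‖x‖ := by
    intro t ht
    have h1 : ‖x - t * z‖ < (1 - t * ‖z‖) / 2 := ht.1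
    have h2 : ‖x‖ - ‖(t : ℂ) * z‖ ≤ ‖x - t * z‖ := norm_sub_norm_le _ _
    rw [hnz t ht] at h2
    linarith
  rcases (T ∩ Set.Ioo 0 1).eq_empty_or_nonempty with hE | ⟨t₀, ht₀⟩
  · simp [hE]
  have hvol : volume (T ∩ Set.Ioo 0 1) ≤ ENNReal.ofReal (8 * (1 - ‖x‖)) := by
    -- If `|z|` is small, the triangle inequality says nothing about `t`, but then `1 - |x|` is
    -- bounded below.
    rcases le_total (1 / 2) ‖z‖ with hz2 | hz2
    · have hsub : T ∩ Set.Ioo 0 1 ⊆ Set.Icc (t₀ - 4 * (1 - ‖x‖)) (t₀ + 4 * (1 - ‖x‖)) := by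
        intro t ht
        have h1 : ‖x - t * z‖ < (1 - t * ‖z‖) / 2 := ht.1
        have h2 : ‖x - t₀ * z‖ < (1 - t₀ * ‖z‖) / 2 := ht₀.1
        have h3 := hup t ht
        have h4 := hup t₀ ht₀
        have h5 : ‖((t - t₀ : ℝ) : ℂ) * z‖ ≤ ‖x - t₀ * z‖ + ‖x - t * z‖ := by
          have : ((t - t₀ : ℝ) : ℂ) * z = (x - t₀ * z) - (x - t * z) := by push_cast; ring
          rw [this]; exact norm_sub_le _ _
        rw [norm_mul, Complex.norm_real, Real.norm_eq_abs] at h5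
        have h6 : |t - t₀| ≤ 4 * (1 - ‖x‖) := by nlinarith [abs_nonneg (t - t₀)]
        rw [abs_le] at h6
        constructor <;> linarith
      refine (measure_mono hsub).trans (le_of_eq ?_)
      rw [Real.volume_Icc]; congr 1; ring
    · have h1 := hup t₀ ht₀
      have h2 : t₀ * ‖z‖ ≤ 1 / 2 := by nlinarith [ht₀.2.1, ht₀.2.2, norm_nonneg z]
      calc volume (T ∩ Set.Ioo 0 1) ≤ volume (Set.Ioo (0 : ℝ) 1) :=
            measure_mono Set.inter_subset_right
        _ = ENNReal.ofReal 1 := by simp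
        _ ≤ _ := ENNReal.ofReal_le_ofReal (by linarith)
  have hker : 1 ≤ 5 ^ N * discKernel N N z x := by
    have h1 := hup t₀ ht₀
    have h2 : ‖x - t₀ * z‖ < (1 - t₀ * ‖z‖) / 2 := ht₀.1
    have h3 : ‖x - z‖ ≤ 3 * (1 - ‖x‖) := by
      have h4 : ‖x - z‖ ≤ ‖x - t₀ * z‖ + ‖((1 - t₀ : ℝ) : ℂ) * z‖ := by
        have : x - z = (x - t₀ * z) - ((1 - t₀ : ℝ) : ℂ) * z := by push_cast; ring
        rw [this]; exact norm_sub_le _ _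
      rw [norm_mul, Complex.norm_real, Real.norm_of_nonneg (by linarith [ht₀.2.2])] at h4
      nlinarith
    have h5 : ‖1 - z * (starRingEnd ℂ) x‖ ≤ 5 * defect x := by
      have h6 : 1 - z * (starRingEnd ℂ) x = ((defect x : ℝ) : ℂ) + (x - z) * (starRingEnd ℂ) x := by
        have := Complex.mul_conj' x
        rw [defect]; push_cast; linear_combination -this
      have h7 : ‖(x - z) * (starRingEnd ℂ) x‖ ≤ 3 * (1 - ‖x‖) := by
        rw [norm_mul, RCLike.norm_conj]
        nlinarith [norm_nonneg x, norm_nonneg (x - z)]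
      have h8 : ‖((defect x : ℝ) : ℂ)‖ = defect x := by
        rw [Complex.norm_real, Real.norm_of_nonneg (defect_pos hx).le]
      have h9 := le_defect hx
      rw [h6]
      refine (norm_add_le _ _).trans ?_
      rw [h8]
      linarith
    rw [discKernel, ← mul_div_assoc, ← Real.mul_rpow (by norm_num) (defect_pos hx).le,
      one_le_div (Real.rpow_pos_of_pos (norm_one_sub_mul_pos hz hx) _)]
    exact Real.rpow_le_rpow (norm_nonneg _) h5 hN
  calc ∫⁻ t in T ∩ Set.Ioo 0 1, ENNReal.ofReal (S / ((1 - t * ‖z‖) / 2) ^ 2)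
      ≤ ∫⁻ t in T ∩ Set.Ioo 0 1, ENNReal.ofReal (S / ((1 - ‖x‖) / 3) ^ 2) := by
        refine setLIntegral_mono' (hTm.inter measurableSet_Ioo) fun t ht => ?_
        have := hlow t ht
        gcongr
    _ = ENNReal.ofReal (S / ((1 - ‖x‖) / 3) ^ 2) * volume (T ∩ Set.Ioo 0 1) := by
        rw [setLIntegral_const]
    _ ≤ ENNReal.ofReal (S / ((1 - ‖x‖) / 3) ^ 2) * ENNReal.ofReal (8 * (1 - ‖x‖)) := by gcongr
    _ = ENNReal.ofReal (72 * S / (1 - ‖x‖)) := by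
        rw [← ENNReal.ofReal_mul (by positivity)]
        congr 1
        field_simp
        ring
    _ ≤ _ := by
        refine ENNReal.ofReal_le_ofReal ?_
        have hd := defect_pos hx
        have h1 : 72 * S / (1 - ‖x‖) ≤ 144 * S / defect x := by
          rw [div_le_div_iff₀ hρ hd]
          nlinarith [defect_le hx]
        have h2 : discKernel (N - 1) N z x = discKernel N N z x / defect x := by
          rw [sub_eq_add_neg, ← discKernel_mul_defect_rpow _ _ _ _ hx, Real.rpow_neg_one,
            div_eq_mul_inv]
        calc 72 * S / (1 - ‖x‖) ≤ 144 * S / defect x * 1 := by rw [mul_one]; exact h1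
          _ ≤ 144 * S / defect x * (5 ^ N * discKernel N N z x) := by gcongr
          _ = _ := by rw [h2]; ring

/-- A function on the disc is controlled by the derivative of `w k(w)` through a kernel with an
arbitrarily large exponent. -/
theorem enorm_le_lintegral_deriv_id_mul_discKernel {N : ℝ} (hN : 0 ≤ N) {k : ℂ → ℂ}
    (hk : DifferentiableOn ℂ k (ball 0 1)) {z : ℂ} (hz : ‖z‖ < 1) :
    ‖k z‖ₑ ≤ ∫⁻ x in ball (0 : ℂ) 1, ‖deriv (fun w => w * k w) x‖ₑ *
      ENNReal.ofReal (144 * 5 ^ N * subMeanConst 1 * discKernel (N - 1) N z x) := by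
  set G : ℂ → ℂ := deriv fun w => w * k w with hG
  have hmul : DifferentiableOn ℂ (fun w => w * k w) (ball 0 1) :=
    DifferentiableOn.fun_mul differentiableOn_id hk
  have hGd : DifferentiableOn ℂ G (ball 0 1) := hmul.deriv isOpen_ball
  have hS := subMeanConst_pos 1
  set W : ℝ → ℂ → ENNReal := fun t x =>
    {t : ℝ | ‖x - t * z‖ < (1 - t * ‖z‖) / 2}.indicator
      (fun t => ENNReal.ofReal (subMeanConst 1 / ((1 - t * ‖z‖) / 2) ^ 2)) t with hW
  have hGm : Measurable ((ball (0 : ℂ) 1).indicator fun x => ‖G x‖ₑ) :=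
    measurable_indicator_of_continuousOn measurableSet_ball hGd.continuousOn.enorm
  have hWm : Measurable fun q : ℝ × ℂ => W q.1 q.2 := by
    have h1 : MeasurableSet {q : ℝ × ℂ | ‖q.2 - q.1 * z‖ < (1 - q.1 * ‖z‖) / 2} :=
      (isOpen_lt (by fun_prop) (by fun_prop)).measurableSet
    have h2 : Measurable fun q : ℝ × ℂ =>
        ENNReal.ofReal (subMeanConst 1 / ((1 - q.1 * ‖z‖) / 2) ^ 2) := by fun_prop
    exact h2.indicator h1
  have hpt : ∀ t ∈ Set.Ioo (0 : ℝ) 1, ‖G (t * z)‖ₑ ≤ ∫⁻ x in ball (0 : ℂ) 1, W t x * ‖G x‖ₑ := by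
    intro t ht
    have hnz : ‖(t : ℂ) * z‖ = t * ‖z‖ := by
      rw [norm_mul, Complex.norm_real, Real.norm_of_nonneg ht.1.le]
    have htz : ‖(t : ℂ) * z‖ < 1 := by rw [hnz]; nlinarith [ht.1, ht.2, norm_nonneg z]
    have hsub := ball_subset_unit_ball htz
    have h1 := enorm_rpow_le_lintegral_ball one_pos le_rfl (by linarith) (hGd.mono hsub)
    simp only [ENNReal.rpow_one] at h1
    refine h1.trans ?_
    rw [hnz] at hsub ⊢
    rw [← lintegral_const_mul' _ _ ENNReal.ofReal_ne_top]
    refine le_trans (le_of_eq ?_) (lintegral_mono_set (ball_subset_closedBall.trans hsub))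
    refine setLIntegral_congr_fun measurableSet_ball fun x hx => ?_
    have hmem : t ∈ {t : ℝ | ‖x - t * z‖ < (1 - t * ‖z‖) / 2} := mem_ball_iff_norm.1 hx
    simp only [hW]
    rw [Set.indicator_of_mem hmem]
  calc ‖k z‖ₑ ≤ ∫⁻ t in Set.Ioo (0 : ℝ) 1, ‖G (t * z)‖ₑ := enorm_le_lintegral_deriv_id_mul hk hz
    _ ≤ ∫⁻ t in Set.Ioo (0 : ℝ) 1, ∫⁻ x in ball (0 : ℂ) 1, W t x * ‖G x‖ₑ :=
        setLIntegral_mono' measurableSet_Ioo hpt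
    _ = ∫⁻ t in Set.Ioo (0 : ℝ) 1, ∫⁻ x in ball (0 : ℂ) 1,
          W t x * (ball (0 : ℂ) 1).indicator (fun x => ‖G x‖ₑ) x := by
        refine lintegral_congr fun t => setLIntegral_congr_fun measurableSet_ball fun x hx => ?_
        simp only [Set.indicator_of_mem hx]
    _ = ∫⁻ x in ball (0 : ℂ) 1, ∫⁻ t in Set.Ioo (0 : ℝ) 1,
          W t x * (ball (0 : ℂ) 1).indicator (fun x => ‖G x‖ₑ) x :=
        lintegral_lintegral_swap (hWm.mul (hGm.comp measurable_snd)).aemeasurable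
    _ ≤ _ := by
        refine setLIntegral_mono' measurableSet_ball fun x hx => ?_
        have hWx : Measurable fun t => W t x := hWm.comp (f := fun t => (t, x)) (by fun_prop)
        rw [lintegral_mul_const _ hWx, Set.indicator_of_mem hx, mul_comm]
        gcongr
        exact lintegral_segment_le hS hN hz (by simpa using hx)

/-! ### Integrals of powers -/

theorem lintegral_Ioi_rpow {a c : ℝ} (ha : a < -1) (hc : 0 < c) :
    ∫⁻ x in Set.Ioi c, ENNReal.ofReal (x ^ a) = ENNReal.ofReal (-c ^ (a + 1) / (a + 1)) := by
  rw [← integral_Ioi_rpow_of_lt ha hc, ofReal_integral_eq_lintegral_ofReal]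
  · exact integrableOn_Ioi_rpow_of_lt ha hc
  · exact (ae_restrict_mem measurableSet_Ioi).mono fun x hx =>
      Real.rpow_nonneg (hc.le.trans (le_of_lt hx)) _

theorem lintegral_Ioc_rpow {a c : ℝ} (ha : -1 < a) (hc : 0 < c) :
    ∫⁻ x in Set.Ioc 0 c, ENNReal.ofReal (x ^ a) = ENNReal.ofReal (c ^ (a + 1) / (a + 1)) := by
  have h := integral_rpow (a := 0) (b := c) (Or.inl ha)
  rw [intervalIntegral.integral_of_le hc.le, Real.zero_rpow (by linarith), sub_zero] at h
  rw [← h, ofReal_integral_eq_lintegral_ofReal]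
  · have := intervalIntegral.intervalIntegrable_rpow' (a := 0) (b := c) ha
    rwa [intervalIntegrable_iff_integrableOn_Ioc_of_le hc.le] at this
  · exact (ae_restrict_mem measurableSet_Ioc).mono fun x hx => Real.rpow_nonneg hx.1.le _

theorem lintegral_rpow_add_abs_le {t y : ℝ} (ht : 1 < t) (hy : 0 < y) :
    ∫⁻ θ : ℝ, ENNReal.ofReal ((y + |θ|) ^ (-t)) ≤
      ENNReal.ofReal (2 / (t - 1) * y ^ (1 - t)) := by
  set g : ℝ → ENNReal := fun θ => ENNReal.ofReal ((y + |θ|) ^ (-t)) with hg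
  have hpos : ∫⁻ θ in Set.Ioi (0 : ℝ), g θ = ENNReal.ofReal (y ^ (1 - t) / (t - 1)) := by
    have h1 := lintegral_Ioi_rpow (a := -t) (by linarith) hy
    rw [← lintegral_indicator measurableSet_Ioi, ← lintegral_add_left_eq_self _ y] at h1
    rw [← lintegral_indicator measurableSet_Ioi]
    convert h1 using 1
    · refine lintegral_congr fun θ => ?_
      by_cases hθ : 0 < θ
      · rw [Set.indicator_of_mem (show θ ∈ Set.Ioi 0 from hθ),
          Set.indicator_of_mem (show y + θ ∈ Set.Ioi y by simpa using hθ), hg]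
        simp only [abs_of_pos hθ]
      · rw [Set.indicator_of_notMem (by simpa using hθ),
          Set.indicator_of_notMem (by simpa using hθ)]
    · congr 1
      rw [show -t + 1 = -(t - 1) by ring, neg_div_neg_eq, neg_sub]
  have hneg : ∫⁻ θ in Set.Iio (0 : ℝ), g θ = ∫⁻ θ in Set.Ioi (0 : ℝ), g θ := by
    rw [← lintegral_indicator measurableSet_Ioi, ← lintegral_indicator measurableSet_Iio,
      ← lintegral_neg_eq_self]
    refine lintegral_congr fun θ => ?_
    simp [Set.indicator, hg]
  have huniv : ∫⁻ θ : ℝ, g θ = (∫⁻ θ in Set.Iio (0 : ℝ), g θ) + ∫⁻ θ in Set.Ioi (0 : ℝ), g θ := by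
    rw [← lintegral_add_compl _ measurableSet_Iio, Set.compl_Iio, setLIntegral_congr Ioi_ae_eq_Ici]
  rw [huniv, hneg, hpos, ← ENNReal.ofReal_add (by have : 0 < t - 1 := by linarith
                                                  positivity)
    (by have : 0 < t - 1 := by linarith
        positivity)]
  refine ENNReal.ofReal_le_ofReal (le_of_eq ?_)
  ring

/-- The radial part of the Forelli–Rudin estimate; `u` stands for `1 - |z|` and `ρ` for `1 - |x|`. -/
theorem lintegral_rpow_mul_add_rpow_le {c t ρ : ℝ} (hc : -1 < c) (ht : c + 2 < t) (hρ : 0 < ρ) :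
    ∫⁻ u in Set.Ioi (0 : ℝ), ENNReal.ofReal (u ^ c * (ρ + u) ^ (1 - t)) ≤
      ENNReal.ofReal ((1 / (c + 1) + 1 / (t - c - 2)) * ρ ^ (c + 2 - t)) := by
  have hc1 : 0 < c + 1 := by linarith
  have ht1 : 0 < t - c - 2 := by linarith
  rw [← Set.Ioc_union_Ioi_eq_Ioi hρ.le,
    lintegral_union measurableSet_Ioi (Set.Ioc_disjoint_Ioi le_rfl), add_mul,
    ENNReal.ofReal_add (by positivity) (by positivity)]
  refine add_le_add ?_ ?_
  · calc ∫⁻ u in Set.Ioc 0 ρ, ENNReal.ofReal (u ^ c * (ρ + u) ^ (1 - t))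
        ≤ ∫⁻ u in Set.Ioc 0 ρ, ENNReal.ofReal (ρ ^ (1 - t)) * ENNReal.ofReal (u ^ c) := by
          refine setLIntegral_mono' measurableSet_Ioc fun u hu => ?_
          rw [← ENNReal.ofReal_mul (by positivity), mul_comm]
          refine ENNReal.ofReal_le_ofReal (mul_le_mul_of_nonneg_right ?_
            (Real.rpow_nonneg hu.1.le _))
          exact Real.rpow_le_rpow_of_nonpos hρ (by linarith [hu.1]) (by linarith)
      _ = _ := by
          rw [lintegral_const_mul' _ _ ENNReal.ofReal_ne_top, lintegral_Ioc_rpow hc hρ,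
            ← ENNReal.ofReal_mul (by positivity), ← mul_div_assoc, ← Real.rpow_add hρ]
          congr 1
          rw [div_mul_eq_mul_div, one_mul]
          congr 2
          ring
  · calc ∫⁻ u in Set.Ioi ρ, ENNReal.ofReal (u ^ c * (ρ + u) ^ (1 - t))
        ≤ ∫⁻ u in Set.Ioi ρ, ENNReal.ofReal (u ^ (c + 1 - t)) := by
          refine setLIntegral_mono' measurableSet_Ioi fun u hu => ?_
          have hu0 : 0 < u := hρ.trans hu
          refine ENNReal.ofReal_le_ofReal ?_
          rw [add_sub_assoc, Real.rpow_add hu0]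
          exact mul_le_mul_of_nonneg_left
            (Real.rpow_le_rpow_of_nonpos hu0 (by linarith) (by linarith)) (by positivity)
      _ = _ := by
          rw [lintegral_Ioi_rpow (by linarith) hρ]
          congr 1
          rw [show c + 1 - t + 1 = -(t - c - 2) by ring, neg_div_neg_eq, div_mul_eq_mul_div, one_mul]
          congr 2
          ring

/-! ### The Forelli–Rudin estimate -/

theorem abs_div_pi_le_norm_one_sub {x θ : ℝ} (hx : 0 ≤ x) (hθ : |θ| ≤ Real.pi) :
    |θ| / Real.pi ≤ ‖1 - circleMap 0 x θ‖ := by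
  have hre : (1 - circleMap 0 x θ).re = 1 - x * Real.cos θ := by
    simp [circleMap, Complex.exp_re]
  have him : (1 - circleMap 0 x θ).im = -(x * Real.sin θ) := by
    simp [circleMap, Complex.exp_im]
  rcases le_total |θ| (Real.pi / 2) with h | h
  · have h1 : 2 / Real.pi * |θ| ≤ |Real.sin θ| := Real.mul_abs_le_abs_sin h
    have h2 : |Real.sin θ| ≤ ‖1 - circleMap 0 x θ‖ := by
      rw [← abs_of_nonneg (norm_nonneg _), ← sq_le_sq, Complex.sq_norm, Complex.normSq_apply, hre,
        him]
      nlinarith [sq_nonneg (x - Real.cos θ), Real.sin_sq_add_cos_sq θ]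
    refine le_trans ?_ (h1.trans h2)
    rw [div_mul_eq_mul_div]
    gcongr
    linarith [abs_nonneg θ]
  · have h1 : Real.cos θ ≤ 0 := by
      rw [← Real.cos_abs]
      exact Real.cos_nonpos_of_pi_div_two_le_of_le h (by linarith)
    have h2 : 1 ≤ ‖1 - circleMap 0 x θ‖ := by
      refine le_trans ?_ (Complex.re_le_norm _)
      rw [hre]
      nlinarith
    exact ((div_le_one Real.pi_pos).2 hθ).trans h2

theorem le_six_mul_norm_one_sub_circleMap_mul {s r θ : ℝ} (hs0 : 0 ≤ s) (hs1 : s < 1) (hr0 : 0 ≤ r)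
    (hr1 : r < 1) (hθ : |θ| ≤ Real.pi) :
    (1 - s) + (1 - r) + |θ| ≤ 6 * ‖1 - circleMap 0 r θ * s‖ := by
  have h0 : circleMap 0 r θ * s = circleMap 0 (r * s) θ := by
    simp [circleMap]; ring
  have h1 := abs_div_pi_le_norm_one_sub (x := r * s) (by positivity) hθ
  have h2 : 1 - r * s ≤ ‖1 - circleMap 0 (r * s) θ‖ := by
    have := norm_sub_norm_le (1 : ℂ) (circleMap 0 (r * s) θ)
    rwa [norm_one, norm_circleMap_zero, abs_of_nonneg (by positivity)] at this
  rw [h0]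
  rw [div_le_iff₀ Real.pi_pos] at h1
  nlinarith [Real.pi_lt_four, norm_nonneg (1 - circleMap 0 (r * s) θ)]

/-- The Forelli–Rudin estimate on the unit disc. -/
theorem exists_lintegral_rpow_div_le {c t : ℝ} (hc : -1 < c) (ht : c + 2 < t) :
    ∃ C : ℝ, 0 ≤ C ∧ ∀ x : ℂ, ‖x‖ < 1 →
      ∫⁻ z in ball (0 : ℂ) 1, ENNReal.ofReal ((1 - ‖z‖) ^ c / ‖1 - z * (starRingEnd ℂ) x‖ ^ t) ≤
        ENNReal.ofReal (C * (1 - ‖x‖) ^ (c + 2 - t)) := by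
  have ht1 : 1 < t := by linarith
  have ht1' : 0 < t - 1 := by linarith
  have hc1 : 0 < c + 1 := by linarith
  have ht2 : 0 < t - c - 2 := by linarith
  refine ⟨6 ^ t * (2 / (t - 1)) * (1 / (c + 1) + 1 / (t - c - 2)), by positivity, fun x hx => ?_⟩
  -- By rotation invariance `x` may be replaced by `s = |x|`.
  set s := ‖x‖ with hs
  have hs0 : 0 ≤ s := norm_nonneg x
  obtain ⟨u, hu1, hu⟩ : ∃ u : ℂ, ‖u‖ = 1 ∧ x = u * s := by
    rcases eq_or_ne x 0 with rfl | hx0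
    · exact ⟨1, by simp, by simp [hs]⟩
    · refine ⟨x / s, ?_, ?_⟩
      · rw [norm_div, Complex.norm_real, norm_norm, div_self (norm_ne_zero_iff.2 hx0)]
      · rw [div_mul_cancel₀]
        simpa [hs] using hx0
  set Φ : ℂ → ENNReal := (ball (0 : ℂ) 1).indicator fun z =>
    ENNReal.ofReal ((1 - ‖z‖) ^ c / ‖1 - z * (starRingEnd ℂ) x‖ ^ t) with hΦ
  have hΦm : Measurable Φ := by
    refine Measurable.indicator ?_ measurableSet_ball
    have h : Continuous fun z : ℂ => ‖1 - z * (starRingEnd ℂ) x‖ := by fun_prop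
    exact (Measurable.div (Measurable.pow_const (by fun_prop) _)
      (h.measurable.pow_const _)).ennreal_ofReal
  have hrot : ∫⁻ z, Φ z = ∫⁻ z, Φ (u * z) := by
    have := (rotation ⟨u, by simp [Submonoid.unitSphere, hu1]⟩).measurePreserving.lintegral_comp hΦm
    rw [← this]
    rfl
  have hΦu : ∀ z : ℂ, Φ (u * z) = (ball (0 : ℂ) 1).indicator (fun z =>
      ENNReal.ofReal ((1 - ‖z‖) ^ c / ‖1 - z * s‖ ^ t)) z := by
    intro z
    have h1 : ‖u * z‖ = ‖z‖ := by rw [norm_mul, hu1, one_mul]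
    have h2 : u * z * (starRingEnd ℂ) x = z * s := by
      have h3 : u * (starRingEnd ℂ) u = 1 := by rw [Complex.mul_conj', hu1]; simp
      rw [hu, map_mul, Complex.conj_ofReal]
      linear_combination (z * s) * h3
    simp only [hΦ, Set.indicator, mem_ball_zero_iff, h1, h2]
  rw [← lintegral_indicator measurableSet_ball, hrot,
    lintegral_eq_lintegral_circleMap (f := fun z => Φ (u * z)) (hΦm.comp (by fun_prop))]
  have hρ : 0 < 1 - s := by linarith
  calc ∫⁻ r in Set.Ioi (0 : ℝ), ∫⁻ θ in Set.Ioo (-Real.pi) Real.pi,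
          ENNReal.ofReal r * Φ (u * circleMap 0 r θ)
      ≤ ∫⁻ r in Set.Ioi (0 : ℝ), (Set.Ioo (0 : ℝ) 1).indicator (fun r => ENNReal.ofReal
          (6 ^ t * (2 / (t - 1)) * ((1 - r) ^ c * ((1 - s) + (1 - r)) ^ (1 - t)))) r := by
        refine setLIntegral_mono' measurableSet_Ioi fun r hr => ?_
        have hr0 : (0 : ℝ) < r := hr
        have hnorm : ∀ θ, ‖circleMap 0 r θ‖ = r := fun θ => by
          rw [norm_circleMap_zero, abs_of_pos hr0]
        by_cases hr1 : r < 1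
        · rw [Set.indicator_of_mem (show r ∈ Set.Ioo (0 : ℝ) 1 from ⟨hr0, hr1⟩)]
          have hr1' : 0 < 1 - r := by linarith
          calc ∫⁻ θ in Set.Ioo (-Real.pi) Real.pi, ENNReal.ofReal r * Φ (u * circleMap 0 r θ)
              ≤ ∫⁻ θ in Set.Ioo (-Real.pi) Real.pi, ENNReal.ofReal (6 ^ t * (1 - r) ^ c) *
                  ENNReal.ofReal ((((1 - s) + (1 - r)) + |θ|) ^ (-t)) := by
                refine setLIntegral_mono' measurableSet_Ioo fun θ hθ => ?_
                rw [hΦu, Set.indicator_of_mem (by simpa [hnorm] using hr1), hnorm,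
                  ← ENNReal.ofReal_mul hr0.le, ← ENNReal.ofReal_mul (by positivity)]
                refine ENNReal.ofReal_le_ofReal ?_
                have h1 := le_six_mul_norm_one_sub_circleMap_mul hs0 hx hr0.le hr1
                  (abs_le.2 ⟨hθ.1.le, hθ.2.le⟩)
                set Y := (1 - s) + (1 - r) + |θ| with hY
                have hY0 : 0 < Y := by positivity
                have h2 : 0 < ‖1 - circleMap 0 r θ * s‖ := by linarith
                have h3 : (‖1 - circleMap 0 r θ * s‖ ^ t)⁻¹ ≤ 6 ^ t * Y ^ (-t) := by
                  rw [Real.rpow_neg hY0.le, ← Real.inv_rpow hY0.le,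
                    ← Real.mul_rpow (by norm_num) (by positivity), ← Real.inv_rpow h2.le]
                  refine Real.rpow_le_rpow (by positivity) ?_ (by linarith)
                  rw [inv_eq_one_div, ← div_eq_mul_inv, div_le_div_iff₀ h2 hY0]
                  linarith
                calc r * ((1 - r) ^ c / ‖1 - circleMap 0 r θ * s‖ ^ t)
                    ≤ 1 * ((1 - r) ^ c / ‖1 - circleMap 0 r θ * s‖ ^ t) := by gcongr
                  _ = (1 - r) ^ c * (‖1 - circleMap 0 r θ * s‖ ^ t)⁻¹ := by
                      rw [one_mul, div_eq_mul_inv]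
                  _ ≤ (1 - r) ^ c * (6 ^ t * Y ^ (-t)) := by gcongr
                  _ = _ := by ring
            _ ≤ ENNReal.ofReal (6 ^ t * (1 - r) ^ c) *
                  ∫⁻ θ : ℝ, ENNReal.ofReal ((((1 - s) + (1 - r)) + |θ|) ^ (-t)) := by
                rw [lintegral_const_mul' _ _ ENNReal.ofReal_ne_top]
                gcongr
                exact Measure.restrict_le_self
            _ ≤ ENNReal.ofReal (6 ^ t * (1 - r) ^ c) *
                  ENNReal.ofReal (2 / (t - 1) * ((1 - s) + (1 - r)) ^ (1 - t)) := by
                gcongr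
                exact lintegral_rpow_add_abs_le ht1 (by linarith)
            _ = _ := by
                rw [← ENNReal.ofReal_mul (by positivity)]
                congr 1
                ring
        · have hz : ∀ θ, Φ (u * circleMap 0 r θ) = 0 := fun θ => by
            rw [hΦu, Set.indicator_of_notMem (by simpa [hnorm] using hr1)]
          simp [hz]
    _ ≤ ∫⁻ r : ℝ, (Set.Ioo (0 : ℝ) 1).indicator (fun r => ENNReal.ofReal
          (6 ^ t * (2 / (t - 1)) * ((1 - r) ^ c * ((1 - s) + (1 - r)) ^ (1 - t)))) r :=
        setLIntegral_le_lintegral _ _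
    _ = ∫⁻ v : ℝ, (Set.Ioo (0 : ℝ) 1).indicator (fun v => ENNReal.ofReal
          (6 ^ t * (2 / (t - 1)) * (v ^ c * ((1 - s) + v) ^ (1 - t)))) v := by
        rw [← lintegral_sub_left_eq_self _ (1 : ℝ)]
        refine lintegral_congr fun v => ?_
        have : 1 - v ∈ Set.Ioo (0 : ℝ) 1 ↔ v ∈ Set.Ioo (0 : ℝ) 1 := by
          constructor <;> rintro ⟨h1, h2⟩ <;> constructor <;> linarith
        by_cases hv : v ∈ Set.Ioo (0 : ℝ) 1
        · rw [Set.indicator_of_mem hv, Set.indicator_of_mem (this.2 hv)]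
          simp
        · rw [Set.indicator_of_notMem hv, Set.indicator_of_notMem (fun h => hv (this.1 h))]
    _ ≤ ∫⁻ v in Set.Ioi (0 : ℝ), ENNReal.ofReal (6 ^ t * (2 / (t - 1))) *
          ENNReal.ofReal (v ^ c * ((1 - s) + v) ^ (1 - t)) := by
        rw [lintegral_indicator measurableSet_Ioo]
        refine (lintegral_mono_set fun v hv => hv.1).trans (le_of_eq ?_)
        refine lintegral_congr fun v => ?_
        rw [← ENNReal.ofReal_mul (by positivity)]
    _ ≤ ENNReal.ofReal (6 ^ t * (2 / (t - 1))) *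
          ENNReal.ofReal ((1 / (c + 1) + 1 / (t - c - 2)) * (1 - s) ^ (c + 2 - t)) := by
        rw [lintegral_const_mul' _ _ ENNReal.ofReal_ne_top]
        gcongr
        exact lintegral_rpow_mul_add_rpow_le hc ht hρ
    _ = _ := by
        rw [← ENNReal.ofReal_mul (by positivity)]
        congr 1
        ring

/-! ### Growth of the weights -/

theorem IsClassS.pos {ω : ℝ → ℝ} {m q M : ℝ} (h : IsClassS ω m q M) {r : ℝ}
    (hr : r ∈ Set.Ioo (0 : ℝ) 1) : 0 < ω r := by
  refine lt_of_le_of_ne (h.nonneg r hr) fun h0 => ?_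
  have h1 := h.lower r hr 1 ⟨h.q_mem.2.le, le_rfl⟩
  rw [← h0, div_zero] at h1
  exact absurd h.m_mem.1 (not_lt.2 h1)

theorem IsClassS.mul_le {ω : ℝ → ℝ} {m q M : ℝ} (h : IsClassS ω m q M) {r l : ℝ}
    (hr : r ∈ Set.Ioo (0 : ℝ) 1) (hl : l ∈ Set.Icc q 1) : m * ω r ≤ ω (l * r) :=
  (le_div_iff₀ (h.pos hr)).1 (h.lower r hr l hl)

theorem alphaIndex_pos {m q : ℝ} (hm : m ∈ Set.Ioo (0 : ℝ) 1) (hq : q ∈ Set.Ioo (0 : ℝ) 1) :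
    0 < alphaIndex m q := by
  rw [alphaIndex, Real.log_inv, div_neg, neg_neg]
  exact div_pos_of_neg_of_neg (Real.log_neg hm.1 hm.2) (Real.log_neg hq.1 hq.2)

theorem rpow_alphaIndex {m q : ℝ} (hm : m ∈ Set.Ioo (0 : ℝ) 1) (hq : q ∈ Set.Ioo (0 : ℝ) 1) :
    q ^ alphaIndex m q = m := by
  have hlog := Real.log_neg hq.1 hq.2
  rw [Real.rpow_def_of_pos hq.1, alphaIndex, Real.log_inv, div_neg, neg_neg,
    mul_div_cancel₀ _ hlog.ne, Real.exp_log hm.1]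

/-- Iterating the lower bound of the class `S`: the index `alphaIndex m q` is a lower exponent. -/
theorem IsClassS.rpow_alphaIndex_mul_le {ω : ℝ → ℝ} {m q M : ℝ} (h : IsClassS ω m q M) {r l : ℝ}
    (hr : r ∈ Set.Ioo (0 : ℝ) 1) (hl : l ∈ Set.Ioc (0 : ℝ) 1) :
    m * l ^ alphaIndex m q * ω r ≤ ω (l * r) := by
  obtain ⟨hq0, hq1⟩ := h.q_mem
  have hm0 := h.m_mem.1
  have hmem : ∀ {l' : ℝ}, l' ∈ Set.Ioc (0 : ℝ) 1 → l' * r ∈ Set.Ioo (0 : ℝ) 1 := fun hl' =>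
    ⟨mul_pos hl'.1 hr.1, (mul_le_of_le_one_left hr.1.le hl'.2).trans_lt hr.2⟩
  have hpow : ∀ k : ℕ, m ^ k * ω r ≤ ω (q ^ k * r) := by
    intro k
    induction k with
    | zero => simp
    | succ k ih =>
      have h1 := h.mul_le (hmem ⟨pow_pos hq0 k, pow_le_one₀ hq0.le hq1.le⟩) ⟨le_rfl, hq1.le⟩
      calc m ^ (k + 1) * ω r = m * (m ^ k * ω r) := by ring
        _ ≤ m * ω (q ^ k * r) := by gcongr
        _ ≤ ω (q * (q ^ k * r)) := h1
        _ = _ := by congr 1; ring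
  obtain ⟨k, hk1, hk2⟩ := exists_nat_pow_near_of_lt_one hl.1 hl.2 hq0 hq1
  have hqk : 0 < q ^ k := pow_pos hq0 k
  have h1 := h.mul_le (l := l / q ^ k) (hmem ⟨hqk, pow_le_one₀ hq0.le hq1.le⟩)
    ⟨by rw [le_div_iff₀ hqk, ← pow_succ']; exact hk1.le, (div_le_one hqk).2 hk2⟩
  have h2 : l ^ alphaIndex m q ≤ m ^ k := by
    calc l ^ alphaIndex m q ≤ (q ^ k) ^ alphaIndex m q :=
          Real.rpow_le_rpow hl.1.le hk2 (alphaIndex_pos h.m_mem h.q_mem).le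
      _ = (q ^ alphaIndex m q) ^ k := by
          rw [← Real.rpow_natCast, ← Real.rpow_mul hq0.le, mul_comm, Real.rpow_mul hq0.le,
            Real.rpow_natCast]
      _ = m ^ k := by rw [rpow_alphaIndex h.m_mem h.q_mem]
  have hωr := h.pos hr
  calc m * l ^ alphaIndex m q * ω r ≤ m * m ^ k * ω r := by gcongr
    _ = m * (m ^ k * ω r) := by ring
    _ ≤ m * ω (q ^ k * r) := by gcongr; exact hpow k
    _ ≤ ω (l / q ^ k * (q ^ k * r)) := h1
    _ = _ := by congr 1; field_simp

/-- Two-sided control of the weight `ω` on `(0,1)` by the powers `a` and `b`: the form in which the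
hypotheses on the weights are used. Measurability is required on all of `ℝ`, which is harmless as
`ω` matters on `(0,1)` only. -/
structure IsPowerBetween (ω : ℝ → ℝ) (a b K : ℝ) : Prop where
  measurable : Measurable ω
  pos : ∀ r ∈ Set.Ioo (0 : ℝ) 1, 0 < ω r
  const_pos : 0 < K
  one_lt : 1 < b
  le : b ≤ a
  bound : ∀ r ∈ Set.Ioo (0 : ℝ) 1, ∀ s ∈ Set.Ioo (0 : ℝ) 1,
    ω r ≤ K * ω s * ((r / s) ^ a + (r / s) ^ b)

theorem IsClassS.exists_isPowerBetween {ω : ℝ → ℝ} {m q M β : ℝ} (h : IsClassS ω m q M)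
    (hβ : β < -1) (hu : HasUpperExponent ω β) :
    ∃ ω' K, Set.EqOn ω' ω (Set.Ioo 0 1) ∧ IsPowerBetween ω' (alphaIndex m q) (-β) K := by
  obtain ⟨K, hK⟩ := hu
  obtain ⟨ω', hω'm, hω'⟩ := (MeasurableEmbedding.subtype_coe
    measurableSet_Ioo).exists_measurable_extend h.measurable fun _ => ⟨(0 : ℝ)⟩
  have heq : Set.EqOn ω' ω (Set.Ioo 0 1) := fun r hr => congrFun hω' ⟨r, hr⟩
  set a := alphaIndex m q with ha
  have hm0 := h.m_mem.1
  have hhalf : (1 / 2 : ℝ) ∈ Set.Ioo (0 : ℝ) 1 := by constructor <;> norm_num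
  have hcomp : ∀ l ∈ Set.Ioc (0 : ℝ) 1, m * l ^ a ≤ K * l ^ (-β) := fun l hl =>
    le_of_mul_le_mul_right ((h.rpow_alphaIndex_mul_le hhalf hl).trans (hK _ hhalf l hl))
      (h.pos hhalf)
  have hmK : m ≤ K := by simpa using hcomp 1 ⟨one_pos, le_rfl⟩
  have hK0 : 0 < K := hm0.trans_le hmK
  have hba : -β ≤ a := by
    by_contra! hlt
    have he : 0 < -β - a := by linarith
    -- At this `l` the ratio of the two powers of `l` is `m / (2 * K)`, contradicting `hcomp`.
    set l : ℝ := (m / (2 * K)) ^ (1 / (-β - a)) with hl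
    have hl0 : 0 < l := by positivity
    have hl1 : l ≤ 1 := by
      refine Real.rpow_le_one (by positivity) ?_ (by positivity)
      rw [div_le_one (by positivity)]; linarith
    have h1 := hcomp l ⟨hl0, hl1⟩
    have h2 : l ^ (-β) = l ^ a * (m / (2 * K)) := by
      have h3 : l ^ (-β - a) = m / (2 * K) := by
        rw [hl, ← Real.rpow_mul (by positivity), one_div_mul_cancel he.ne', Real.rpow_one]
      rw [← h3, ← Real.rpow_add hl0]; congr 1; ring
    have h4 : K * l ^ (-β) = m / 2 * l ^ a := by rw [h2]; field_simp
    have h5 : 0 < l ^ a := Real.rpow_pos_of_pos hl0 _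
    rw [h4] at h1
    nlinarith
  refine ⟨ω', K + 1 / m, heq, hω'm, fun r hr => heq hr ▸ h.pos hr, by positivity, by linarith, hba,
    fun r hr s hs => ?_⟩
  rw [heq hr, heq hs]
  have hωs := h.pos hs
  have hωr := h.pos hr
  have hrs : 0 < r / s := div_pos hr.1 hs.1
  rcases le_total r s with hle | hle
  · have h1 := hK s hs (r / s) ⟨hrs, (div_le_one hs.1).2 hle⟩
    rw [div_mul_cancel₀ _ hs.1.ne'] at h1
    calc ω r ≤ K * (r / s) ^ (-β) * ω s := h1
      _ = K * ω s * (0 + (r / s) ^ (-β)) := by ring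
      _ ≤ _ := by
        gcongr
        · linarith [one_div_pos.2 hm0]
        · positivity
  · have h1 := h.rpow_alphaIndex_mul_le hr (l := s / r)
      ⟨div_pos hs.1 hr.1, (div_le_one hr.1).2 hle⟩
    rw [div_mul_cancel₀ _ hr.1.ne', ← ha] at h1
    have h2 : (s / r) ^ a = ((r / s) ^ a)⁻¹ := by
      rw [← Real.inv_rpow hrs.le, inv_div]
    rw [h2] at h1
    have h3 : 0 < (r / s) ^ a := by positivity
    calc ω r = 1 / m * (m * ((r / s) ^ a)⁻¹ * ω r) * (r / s) ^ a := by field_simp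
      _ ≤ 1 / m * ω s * (r / s) ^ a := by gcongr
      _ = 1 / m * ω s * ((r / s) ^ a + 0) := by rw [add_zero]
      _ ≤ _ := by
        gcongr
        · linarith
        · positivity

theorem one_sub_norm_mem_Ioo {z : ℂ} (hz0 : z ≠ 0) (hz : ‖z‖ < 1) :
    1 - ‖z‖ ∈ Set.Ioo (0 : ℝ) 1 :=
  ⟨by linarith, by linarith [norm_pos_iff.2 hz0]⟩

theorem ae_restrict_ball_ne_zero :
    ∀ᵐ z ∂volume.restrict (ball (0 : ℂ) 1), z ≠ 0 ∧ ‖z‖ < 1 := by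
  have h1 : ∀ᵐ z : ℂ, z ≠ 0 := by simp [ae_iff]
  filter_upwards [ae_restrict_of_ae h1, ae_restrict_mem measurableSet_ball] with z h0 h2
  exact ⟨h0, by simpa using h2⟩

/-- The Forelli–Rudin estimate with the weight `ω`. The centre is excluded since `ω` is controlled
on the open interval `(0,1)` only. -/
theorem IsPowerBetween.exists_lintegral_le {ω : ℝ → ℝ} {a b K : ℝ} (h : IsPowerBetween ω a b K)
    {s t : ℝ} (hs : 1 < b + s) (ht : a + s < t) :
    ∃ C : ℝ, 0 ≤ C ∧ ∀ x : ℂ, x ≠ 0 → ‖x‖ < 1 →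
      ∫⁻ z in ball (0 : ℂ) 1, ENNReal.ofReal
        (ω (1 - ‖z‖) * defect z ^ (s - 2) / ‖1 - z * (starRingEnd ℂ) x‖ ^ t) ≤
        ENNReal.ofReal (C * (ω (1 - ‖x‖) * defect x ^ (s - t))) := by
  have hba := h.le
  have hK := h.const_pos
  obtain ⟨C₁, hC₁, hI₁⟩ := exists_lintegral_rpow_div_le (c := a + s - 2) (t := t) (by linarith)
    (by linarith)
  obtain ⟨C₂, hC₂, hI₂⟩ := exists_lintegral_rpow_div_le (c := b + s - 2) (t := t) (by linarith)
    (by linarith)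
  refine ⟨K * 4 ^ |s - 2| * 4 ^ |s - t| * (C₁ + C₂), by positivity, fun x hx0 hx => ?_⟩
  set ρ := 1 - ‖x‖ with hρ
  have hρI : ρ ∈ Set.Ioo (0 : ℝ) 1 := one_sub_norm_mem_Ioo hx0 hx
  have hρ0 := hρI.1
  have hωρ := h.pos ρ hρI
  set A := K * ω ρ * 4 ^ |s - 2| with hA
  have hA0 : 0 ≤ A := by positivity
  have hcomp : ∀ {z : ℂ}, ‖z‖ < 1 → ∀ e : ℝ, defect z ^ e ≤ 4 ^ |e| * (1 - ‖z‖) ^ e ∧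
      (1 - ‖z‖) ^ e ≤ 4 ^ |e| * defect z ^ e := fun {z} hz e =>
    have h1 := defect_le hz
    have h2 := le_defect hz
    have h3 : 0 < 1 - ‖z‖ := by linarith
    ⟨rpow_le_four_rpow_abs_mul (defect_pos hz) h3 (by linarith) (by linarith) e,
      rpow_le_four_rpow_abs_mul h3 (defect_pos hz) (by linarith) (by linarith) e⟩
  calc ∫⁻ z in ball (0 : ℂ) 1, ENNReal.ofReal
        (ω (1 - ‖z‖) * defect z ^ (s - 2) / ‖1 - z * (starRingEnd ℂ) x‖ ^ t)
      ≤ ∫⁻ z in ball (0 : ℂ) 1, (ENNReal.ofReal (A * ρ ^ (-a)) * ENNReal.ofReal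
          ((1 - ‖z‖) ^ (a + s - 2) / ‖1 - z * (starRingEnd ℂ) x‖ ^ t) +
          ENNReal.ofReal (A * ρ ^ (-b)) * ENNReal.ofReal
          ((1 - ‖z‖) ^ (b + s - 2) / ‖1 - z * (starRingEnd ℂ) x‖ ^ t)) := by
        refine lintegral_mono_ae (ae_restrict_ball_ne_zero.mono fun z hz => ?_)
        have hr0 : 0 < 1 - ‖z‖ := by linarith [hz.2]
        set r := 1 - ‖z‖ with hr
        set Y := ‖1 - z * (starRingEnd ℂ) x‖ ^ t with hY
        have hY0 : 0 ≤ Y := by positivity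
        have hωr := h.pos r (one_sub_norm_mem_Ioo hz.1 hz.2)
        rw [← ENNReal.ofReal_mul (by positivity), ← ENNReal.ofReal_mul (by positivity),
          ← ENNReal.ofReal_add (by positivity) (by positivity)]
        refine ENNReal.ofReal_le_ofReal ?_
        have hpow : ∀ e : ℝ, (r / ρ) ^ e * r ^ (s - 2) = ρ ^ (-e) * r ^ (e + s - 2) := by
          intro e
          rw [Real.div_rpow hr0.le hρ0.le, Real.rpow_neg hρ0.le, add_sub_assoc,
            Real.rpow_add hr0]
          ring
        have hdef := (hcomp hz.2 (s - 2)).1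
        have hdef0 := defect_pos hz.2
        calc ω r * defect z ^ (s - 2) / Y
            ≤ (K * ω ρ * ((r / ρ) ^ a + (r / ρ) ^ b)) * (4 ^ |s - 2| * r ^ (s - 2)) / Y := by
              gcongr
              exact h.bound r (one_sub_norm_mem_Ioo hz.1 hz.2) ρ hρI
          _ = A * ((r / ρ) ^ a * r ^ (s - 2) + (r / ρ) ^ b * r ^ (s - 2)) / Y := by
              rw [hA]; ring
          _ = _ := by rw [hpow, hpow]; ring
    _ = ENNReal.ofReal (A * ρ ^ (-a)) * (∫⁻ z in ball (0 : ℂ) 1, ENNReal.ofReal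
          ((1 - ‖z‖) ^ (a + s - 2) / ‖1 - z * (starRingEnd ℂ) x‖ ^ t)) +
          ENNReal.ofReal (A * ρ ^ (-b)) * ∫⁻ z in ball (0 : ℂ) 1, ENNReal.ofReal
          ((1 - ‖z‖) ^ (b + s - 2) / ‖1 - z * (starRingEnd ℂ) x‖ ^ t) := by
        rw [lintegral_add_left, lintegral_const_mul' _ _ ENNReal.ofReal_ne_top,
          lintegral_const_mul' _ _ ENNReal.ofReal_ne_top]
        have h : Continuous fun z : ℂ => ‖1 - z * (starRingEnd ℂ) x‖ := by fun_prop
        exact (Measurable.div (Measurable.pow_const (by fun_prop) _)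
          (h.measurable.pow_const _)).ennreal_ofReal.const_mul _
    _ ≤ ENNReal.ofReal (A * ρ ^ (-a)) * ENNReal.ofReal (C₁ * ρ ^ (a + s - 2 + 2 - t)) +
          ENNReal.ofReal (A * ρ ^ (-b)) * ENNReal.ofReal (C₂ * ρ ^ (b + s - 2 + 2 - t)) := by
        gcongr
        · exact hI₁ x hx
        · exact hI₂ x hx
    _ ≤ _ := by
        have hpow : ∀ e : ℝ, ρ ^ (-e) * ρ ^ (e + s - 2 + 2 - t) = ρ ^ (s - t) := by
          intro e
          rw [← Real.rpow_add hρ0]; congr 1; ring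
        have hdx := defect_pos hx
        rw [← ENNReal.ofReal_mul (by positivity), ← ENNReal.ofReal_mul (by positivity),
          ← ENNReal.ofReal_add (by positivity) (by positivity)]
        refine ENNReal.ofReal_le_ofReal ?_
        calc A * ρ ^ (-a) * (C₁ * ρ ^ (a + s - 2 + 2 - t)) +
              A * ρ ^ (-b) * (C₂ * ρ ^ (b + s - 2 + 2 - t))
            = A * C₁ * (ρ ^ (-a) * ρ ^ (a + s - 2 + 2 - t)) +
              A * C₂ * (ρ ^ (-b) * ρ ^ (b + s - 2 + 2 - t)) := by ring
          _ = A * (C₁ + C₂) * ρ ^ (s - t) := by rw [hpow, hpow]; ring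
          _ ≤ A * (C₁ + C₂) * (4 ^ |s - t| * defect x ^ (s - t)) := by
              gcongr
              exact (hcomp hx (s - t)).2
          _ = _ := by rw [hA]; ring

/-! ### Iterated integral inequalities on the polydisc -/

/-- If each `U L` is dominated by an integral of `U (j :: L)` in the `j`-th variable, then `U []` is
dominated by the integral of `U (List.finRange n)` over all variables. -/
theorem le_lintegral_pi_of_forall_le_lintegral {n : ℕ} (μ : Fin n → Measure ℂ)
    [∀ j, SigmaFinite (μ j)] (a : Fin n → ℂ) {k : Fin n → ℂ → ENNReal} (hk : ∀ j, Measurable (k j))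
    {U : List (Fin n) → (Fin n → ℂ) → ENNReal} (hU : ∀ L, Measurable (U L))
    (step : ∀ j L w, w j = a j →
      U L w ≤ ∫⁻ x, k j x * U (j :: L) (Function.update w j x) ∂μ j) :
    U [] a ≤ ∫⁻ w, (∏ j, k j (w j)) * U (List.finRange n) w ∂Measure.pi μ := by
  have main : ∀ L : List (Fin n), L.Nodup →
      U [] a ≤ (∫⋯∫⁻_L.toFinset, (fun w => (∏ i ∈ L.toFinset, k i (w i)) * U L w) ∂μ) a := by
    intro L
    induction L with
    | nil => intro _; simp
    | cons j L ih =>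
      intro hL
      rw [List.nodup_cons] at hL
      have hj : j ∉ L.toFinset := by simpa using hL.1
      refine (ih hL.2).trans ?_
      have hm : Measurable fun w : Fin n → ℂ =>
          (∏ i ∈ insert j L.toFinset, k i (w i)) * U (j :: L) w :=
        (Finset.measurable_prod _ fun i _ => (hk i).comp (measurable_pi_apply i)).mul (hU _)
      rw [List.toFinset_cons, lmarginal_insert' _ hm hj]
      refine lintegral_mono fun y => ?_
      set w := Function.updateFinset a L.toFinset y with hw
      have hwj : w j = a j := by simp [hw, Function.updateFinset, hL.1]
      have hprod : ∀ x, ∏ i ∈ insert j L.toFinset, k i (Function.update w j x i) =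
          (∏ i ∈ L.toFinset, k i (w i)) * k j x := by
        intro x
        rw [Finset.prod_insert hj, Function.update_self, mul_comm]
        congr 1
        refine Finset.prod_congr rfl fun i hi => ?_
        rw [Function.update_of_ne (ne_of_mem_of_not_mem hi hj)]
      have hm2 : Measurable fun x => k j x * U (j :: L) (Function.update w j x) :=
        (hk j).mul ((hU _).comp (measurable_update w))
      simp only [hprod, mul_assoc]
      rw [lintegral_const_mul _ hm2]
      gcongr
      exact step j L w hwj
  have h := main (List.finRange n) (List.nodup_finRange n)
  rwa [List.toFinset_finRange, lmarginal_univ] at h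

theorem lintegral_pi_prod {n : ℕ} (μ : Fin n → Measure ℂ) [∀ j, SigmaFinite (μ j)]
    {g : Fin n → ℂ → ENNReal} (hg : ∀ j, Measurable (g j)) :
    ∫⁻ z, ∏ j, g j (z j) ∂Measure.pi μ = ∏ j, ∫⁻ x, g j x ∂μ j := by
  have main : ∀ s : Finset (Fin n), ∀ a, (∫⋯∫⁻_s, (fun z => ∏ i ∈ s, g i (z i)) ∂μ) a =
      ∏ i ∈ s, ∫⁻ x, g i x ∂μ i := by
    intro s
    induction s using Finset.induction_on with
    | empty => simp
    | insert j s hj ih =>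
      intro a
      have hm : ∀ t : Finset (Fin n), Measurable fun z : Fin n → ℂ => ∏ i ∈ t, g i (z i) := fun t =>
        Finset.measurable_prod _ fun i _ => (hg i).comp (measurable_pi_apply i)
      rw [lmarginal_insert' _ (hm _) hj, Finset.prod_insert hj, ← ih a]
      have hprod : ∀ (w : Fin n → ℂ) x, ∏ i ∈ insert j s, g i (Function.update w j x i) =
          g j x * ∏ i ∈ s, g i (w i) := by
        intro w x
        rw [Finset.prod_insert hj, Function.update_self]
        congr 1
        refine Finset.prod_congr rfl fun i hi => ?_
        rw [Function.update_of_ne (ne_of_mem_of_not_mem hi hj)]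
      simp only [hprod, lintegral_mul_const _ (hg j)]
      rw [lmarginal, lintegral_const_mul (f := fun y => ∏ i ∈ s, g i (Function.updateFinset a s y i)) _
        ((hm s).comp measurable_updateFinset)]
      rfl
  have h := main Finset.univ 0
  rwa [lmarginal_univ] at h

theorem polydisc_eq_pi (n : ℕ) : polydisc n = Set.univ.pi fun _ => ball (0 : ℂ) 1 := by
  ext z; simp [polydisc]

theorem volume_restrict_polydisc (n : ℕ) : (volume : Measure (Fin n → ℂ)).restrict (polydisc n) =
    Measure.pi fun _ => (volume : Measure ℂ).restrict (ball 0 1) := by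
  rw [polydisc_eq_pi, volume_pi, Measure.restrict_pi_pi]

theorem measurableSet_polydisc (n : ℕ) : MeasurableSet (polydisc n) :=
  (isOpen_polydisc n).measurableSet

theorem ae_restrict_polydisc_ne_zero (n : ℕ) :
    ∀ᵐ z ∂volume.restrict (polydisc n), z ∈ polydisc n ∧ ∀ j, z j ≠ 0 := by
  have h1 : ∀ᵐ z ∂volume.restrict (polydisc n), ∀ j, z j ≠ 0 := by
    rw [volume_restrict_polydisc, ae_all_iff]
    intro j
    exact (Measure.quasiMeasurePreserving_eval
      (fun _ : Fin n => (volume : Measure ℂ).restrict (ball 0 1)) j).ae (p := fun x => x ≠ 0)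
      (ae_restrict_ball_ne_zero.mono fun z hz => hz.1)
  exact (ae_restrict_mem (measurableSet_polydisc n)).and h1

/-- The product kernel on the polydisc. -/
noncomputable def polyKernel {n : ℕ} (A B : Fin n → ℝ) (z x : Fin n → ℂ) : ℝ :=
  ∏ j, discKernel (A j) (B j) (z j) (x j)

theorem polyKernel_nonneg {n : ℕ} (A B : Fin n → ℝ) (z : Fin n → ℂ) {x : Fin n → ℂ}
    (hx : x ∈ polydisc n) : 0 ≤ polyKernel A B z x :=
  Finset.prod_nonneg fun j _ => discKernel_nonneg _ _ _ (hx j)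

theorem ofReal_polyKernel {n : ℕ} (A B : Fin n → ℝ) (z : Fin n → ℂ) {x : Fin n → ℂ}
    (hx : x ∈ polydisc n) :
    ENNReal.ofReal (polyKernel A B z x) =
      ∏ j, ENNReal.ofReal (discKernel (A j) (B j) (z j) (x j)) :=
  ENNReal.ofReal_prod_of_nonneg fun j _ => discKernel_nonneg _ _ _ (hx j)

theorem measurable_polyKernel {n : ℕ} (A B : Fin n → ℝ) :
    Measurable fun q : (Fin n → ℂ) × (Fin n → ℂ) => polyKernel A B q.1 q.2 :=
  Finset.measurable_prod _ fun j _ => (measurable_discKernel (A j) (B j)).comp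
    (f := fun q : (Fin n → ℂ) × (Fin n → ℂ) => (q.1 j, q.2 j)) (by fun_prop)

theorem measurable_polyKernel_right {n : ℕ} (A B : Fin n → ℝ) (z : Fin n → ℂ) :
    Measurable (polyKernel A B z) :=
  (measurable_polyKernel A B).comp (f := fun x => (z, x)) (by fun_prop)

theorem polyKernel_rpow {n : ℕ} (A B : Fin n → ℝ) (p : ℝ) (z : Fin n → ℂ) {x : Fin n → ℂ}
    (hx : x ∈ polydisc n) : polyKernel A B z x ^ p =
      polyKernel (fun j => p * A j) (fun j => p * B j) z x := by
  rw [polyKernel, ← Real.finsetProd_rpow _ _ fun j _ => discKernel_nonneg _ _ _ (hx j)]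
  exact Finset.prod_congr rfl fun j _ => discKernel_rpow _ _ _ _ (hx j)

theorem polyKernel_mul_prod_defect_rpow {n : ℕ} (A B E : Fin n → ℝ) (z : Fin n → ℂ)
    {x : Fin n → ℂ} (hx : x ∈ polydisc n) :
    polyKernel A B z x * ∏ j, defect (x j) ^ E j = polyKernel (fun j => A j + E j) B z x := by
  rw [polyKernel, ← Finset.prod_mul_distrib]
  exact Finset.prod_congr rfl fun j _ => discKernel_mul_defect_rpow _ _ _ _ (hx j)

/-- The weighted sub-mean value property of `|F|^p` on the polydisc. -/
theorem enorm_rpow_mul_polyKernel_le {n : ℕ} {p : ℝ} (hp0 : 0 < p) (hp1 : p ≤ 1)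
    (A B : Fin n → ℝ) {F : (Fin n → ℂ) → ℂ} (hF : DifferentiableOn ℂ F (polydisc n))
    {z x : Fin n → ℂ} (hz : z ∈ polydisc n) (hx : x ∈ polydisc n) :
    ‖F x‖ₑ ^ p * ENNReal.ofReal (polyKernel A B z x) ≤
      ENNReal.ofReal (∏ j, weightedSubMeanConst p (A j) (B j)) *
        ∫⁻ w in polydisc n, ‖F w‖ₑ ^ p *
          ENNReal.ofReal (polyKernel (fun j => A j - 2) B z w) := by
  set c : Fin n → ENNReal := fun j => ENNReal.ofReal (discKernel (A j) (B j) (z j) (x j)) with hc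
  have hc0 : ∀ j, c j ≠ 0 := fun j => by
    simpa [hc] using discKernel_pos (A j) (B j) (hz j) (hx j)
  have hct : ∀ j, c j ≠ ⊤ := fun j => ENNReal.ofReal_ne_top
  set C : Fin n → ℝ := fun j => weightedSubMeanConst p (A j) (B j) with hC
  have hC0 : ∀ j, 0 < C j := fun j => weightedSubMeanConst_pos _ _ _
  set X : Fin n → ℂ → ENNReal := fun j y =>
    ENNReal.ofReal (C j * discKernel (A j - 2) (B j) (z j) y) with hX
  have hXm : ∀ j, Measurable (X j) := fun j =>
    ((measurable_discKernel_right _ _ _).const_mul _).ennreal_ofReal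
  set V : (Fin n → ℂ) → ENNReal := (polydisc n).indicator fun w => ‖F w‖ₑ ^ p with hV
  have hVm : Measurable V := measurable_indicator_of_continuousOn (measurableSet_polydisc n)
    (ENNReal.continuous_rpow_const.comp_continuousOn hF.continuousOn.enorm)
  have key := le_lintegral_pi_of_forall_le_lintegral
    (fun _ : Fin n => (volume : Measure ℂ).restrict (ball 0 1)) x
    (k := fun j y => (c j)⁻¹ * X j y) (fun j => (hXm j).const_mul _) (U := fun _ => V)
    (fun _ => hVm) (by
      intro j _ w hw
      by_cases hwP : w ∈ polydisc n
      · have h1 := enorm_rpow_mul_discKernel_le hp0 hp1 (A j) (B j) (hz j) (hx j)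
          (differentiableOn_comp_update hF hwP j)
        rw [← hw, Function.update_eq_self, hw] at h1
        have h2 : V w = (c j)⁻¹ * (‖F w‖ₑ ^ p * c j) := by
          rw [hV, Set.indicator_of_mem hwP, mul_comm, mul_assoc, ENNReal.mul_inv_cancel (hc0 j)
            (hct j), mul_one]
        rw [h2]
        simp only [mul_assoc]
        rw [lintegral_const_mul' _ _ (ENNReal.inv_ne_top.2 (hc0 j))]
        gcongr
        refine h1.trans (le_of_eq ?_)
        refine setLIntegral_congr_fun measurableSet_ball fun y hy => ?_
        simp only [hV]
        rw [Set.indicator_of_mem (update_mem_polydisc hwP j (by simpa using hy)), mul_comm]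
      · rw [hV, Set.indicator_of_notMem hwP]; exact zero_le)
  rw [← volume_restrict_polydisc] at key
  have hVx : V x = ‖F x‖ₑ ^ p := by rw [hV, Set.indicator_of_mem hx]
  rw [hVx] at key
  have hprod : (∏ j, c j) * ∏ j, (c j)⁻¹ = 1 := by
    rw [← Finset.prod_mul_distrib]
    exact Finset.prod_eq_one fun j _ => ENNReal.mul_inv_cancel (hc0 j) (hct j)
  calc ‖F x‖ₑ ^ p * ENNReal.ofReal (polyKernel A B z x)
      = (∏ j, c j) * ‖F x‖ₑ ^ p := by rw [ofReal_polyKernel _ _ _ hx, mul_comm]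
    _ ≤ (∏ j, c j) * ∫⁻ w in polydisc n, (∏ j, (c j)⁻¹ * X j (w j)) * V w := by gcongr
    _ = ∫⁻ w in polydisc n, (∏ j, X j (w j)) * V w := by
        rw [← lintegral_const_mul' _ _ (ENNReal.prod_ne_top fun j _ => hct j)]
        refine lintegral_congr fun w => ?_
        rw [Finset.prod_mul_distrib, ← mul_assoc, ← mul_assoc, hprod, one_mul]
    _ = _ := by
        rw [← lintegral_const_mul' _ _ ENNReal.ofReal_ne_top]
        refine setLIntegral_congr_fun (measurableSet_polydisc n) fun w hw => ?_
        simp only [hV, hX]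
        rw [Set.indicator_of_mem hw, ofReal_polyKernel _ _ _ hw,
          ENNReal.ofReal_prod_of_nonneg fun j _ => (hC0 j).le]
        simp only [ENNReal.ofReal_mul (hC0 _).le, Finset.prod_mul_distrib]
        ring

/-- A holomorphic function on the polydisc is controlled by `diffD f` through a product kernel with
arbitrarily large exponents. -/
theorem enorm_le_lintegral_diffD_mul_polyKernel {n : ℕ} {N : Fin n → ℝ} (hN : ∀ j, 0 ≤ N j)
    {f : (Fin n → ℂ) → ℂ} (hf : DifferentiableOn ℂ f (polydisc n)) {z : Fin n → ℂ}
    (hz : z ∈ polydisc n) :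
    ‖f z‖ₑ ≤ ENNReal.ofReal (∏ j, 144 * 5 ^ N j * subMeanConst 1) *
      ∫⁻ w in polydisc n, ‖diffD f w‖ₑ * ENNReal.ofReal (polyKernel (fun j => N j - 1) N z w) := by
  have hS := subMeanConst_pos 1
  set C : Fin n → ℝ := fun j => 144 * 5 ^ N j * subMeanConst 1 with hC
  have hC0 : ∀ j, 0 < C j := fun j => by rw [hC]; positivity
  set X : Fin n → ℂ → ENNReal := fun j y =>
    ENNReal.ofReal (C j * discKernel (N j - 1) (N j) (z j) y) with hX
  have hXm : ∀ j, Measurable (X j) := fun j =>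
    ((measurable_discKernel_right _ _ _).const_mul _).ennreal_ofReal
  -- The variables are treated one after the other, in the order in which `diffD` differentiates.
  set V : List (Fin n) → (Fin n → ℂ) → ENNReal := fun L =>
    (polydisc n).indicator fun w => ‖L.foldr coordD f w‖ₑ with hV
  have hVm : ∀ L, Measurable (V L) := fun L =>
    measurable_indicator_of_continuousOn (measurableSet_polydisc n)
      (differentiableOn_foldr_coordD L hf).continuousOn.enorm
  have key := le_lintegral_pi_of_forall_le_lintegral
    (fun _ : Fin n => (volume : Measure ℂ).restrict (ball 0 1)) z
    (k := X) hXm (U := V) hVm (by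
      intro j L w hw
      by_cases hwP : w ∈ polydisc n
      · have h1 := enorm_le_lintegral_deriv_id_mul_discKernel (hN j)
          (differentiableOn_comp_update (differentiableOn_foldr_coordD L hf) hwP j) (hz j)
        rw [← hw, Function.update_eq_self, hw] at h1
        simp only [hV]
        rw [Set.indicator_of_mem hwP]
        refine h1.trans (le_of_eq ?_)
        refine setLIntegral_congr_fun measurableSet_ball fun y hy => ?_
        rw [Set.indicator_of_mem (update_mem_polydisc hwP j (by simpa using hy)), mul_comm]
        simp only [List.foldr_cons, coordD, partialDeriv, Function.update_idem,
          Function.update_self]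
        rfl
      · simp only [hV]
        rw [Set.indicator_of_notMem hwP]; exact zero_le)
  rw [← volume_restrict_polydisc] at key
  have hVz : V [] z = ‖f z‖ₑ := by simp only [hV, Set.indicator_of_mem hz, List.foldr_nil]
  rw [hVz] at key
  refine key.trans (le_of_eq ?_)
  rw [← lintegral_const_mul' _ _ ENNReal.ofReal_ne_top]
  refine setLIntegral_congr_fun (measurableSet_polydisc n) fun w hw => ?_
  simp only [hV, hX]
  rw [Set.indicator_of_mem hw, ofReal_polyKernel _ _ _ hw, diffD_eq_foldr_coordD,
    ENNReal.ofReal_prod_of_nonneg fun j _ => (hC0 j).le]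
  simp only [ENNReal.ofReal_mul (hC0 _).le, Finset.prod_mul_distrib]
  ring

/-! ### Integrals to the power `p ≤ 1` -/

/-- For `p ≤ 1`, if `h ^ p` is bounded by a multiple of its own integral, then the `p`-th power of the
integral of `h` is at most a multiple of the integral of `h ^ p`: write `h = h ^ p * h ^ (1 - p)`
and bound the second factor. -/
theorem rpow_lintegral_mul_le {X : Type*} [MeasurableSpace X] {μ : Measure X} {h v : X → ENNReal}
    {p : ℝ} (hp0 : 0 < p) (hp1 : p ≤ 1) {C : ENNReal} (hC0 : C ≠ 0) (hCt : C ≠ ⊤)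
    (hh : ∀ᵐ x ∂μ, h x ^ p ≤ C * ∫⁻ y, h y ^ p * v y ∂μ) :
    (∫⁻ x, h x * v x ∂μ) ^ p ≤ C ^ (1 - p) * ∫⁻ x, h x ^ p * v x ∂μ := by
  set I := ∫⁻ y, h y ^ p * v y ∂μ with hI
  rcases eq_or_ne I ⊤ with hIt | hIt
  · rw [hIt, ENNReal.mul_top]
    · exact le_top
    · simp [ENNReal.rpow_eq_zero_iff, hC0, hCt]
  have hp' : 0 ≤ (1 - p) / p := div_nonneg (by linarith) hp0.le
  have hfin : (C * I) ^ ((1 - p) / p) ≠ ⊤ :=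
    ENNReal.rpow_ne_top_of_nonneg hp' (ENNReal.mul_ne_top hCt hIt)
  have h1 : ∫⁻ x, h x * v x ∂μ ≤ (C * I) ^ ((1 - p) / p) * I := by
    rw [hI, ← lintegral_const_mul' _ _ hfin]
    refine lintegral_mono_ae (hh.mono fun x hx => ?_)
    have h2 : h x = h x ^ p * (h x ^ p) ^ ((1 - p) / p) := by
      rw [← ENNReal.rpow_mul, mul_div_cancel₀ _ hp0.ne',
        ← ENNReal.rpow_add_of_nonneg _ _ hp0.le (by linarith)]
      simp
    calc h x * v x = (h x ^ p) ^ ((1 - p) / p) * (h x ^ p * v x) := by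
          conv_lhs => rw [h2]
          ring
      _ ≤ _ := by gcongr
  calc (∫⁻ x, h x * v x ∂μ) ^ p ≤ ((C * I) ^ ((1 - p) / p) * I) ^ p := by gcongr
    _ = C ^ (1 - p) * (I ^ (1 - p) * I ^ p) := by
        rw [ENNReal.mul_rpow_of_nonneg _ _ hp0.le, ← ENNReal.rpow_mul, div_mul_cancel₀ _ hp0.ne',
          ENNReal.mul_rpow_of_nonneg _ _ (by linarith), mul_assoc]
    _ = C ^ (1 - p) * I := by
        rw [← ENNReal.rpow_add_of_nonneg _ _ (by linarith) hp0.le]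
        simp

/-- For `p ≤ 1` and holomorphic `F`, the `p`-th power of an integral of `|F|` against a product kernel
is at most a constant times an integral of `|F|^p`. -/
theorem exists_rpow_lintegral_mul_polyKernel_le {n : ℕ} {p : ℝ} (hp0 : 0 < p) (hp1 : p ≤ 1)
    (A B : Fin n → ℝ) :
    ∃ C : ENNReal, C ≠ ⊤ ∧ ∀ F : (Fin n → ℂ) → ℂ, DifferentiableOn ℂ F (polydisc n) →
      ∀ z ∈ polydisc n,
        (∫⁻ x in polydisc n, ‖F x‖ₑ * ENNReal.ofReal (polyKernel A B z x)) ^ p ≤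
        C * ∫⁻ x in polydisc n, ‖F x‖ₑ ^ p * ENNReal.ofReal
          (polyKernel (fun j => p * (A j + 2) - 2) (fun j => p * B j) z x) := by
  set C : ENNReal := ENNReal.ofReal
    (∏ j, weightedSubMeanConst p (p * (A j + 2)) (p * B j)) with hC
  have hC0 : C ≠ 0 := by
    have : 0 < ∏ j, weightedSubMeanConst p (p * (A j + 2)) (p * B j) :=
      Finset.prod_pos fun j _ => weightedSubMeanConst_pos _ _ _
    simpa [hC] using this
  have hCt : C ≠ ⊤ := ENNReal.ofReal_ne_top
  refine ⟨C ^ (1 - p), ENNReal.rpow_ne_top_of_nonneg (by linarith) hCt, fun F hF z hz => ?_⟩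
  -- The factor `v` turns Lebesgue measure into the Möbius invariant measure.
  set v : (Fin n → ℂ) → ENNReal := fun x => ENNReal.ofReal (∏ j, defect (x j) ^ (-2 : ℝ)) with hv
  set h : (Fin n → ℂ) → ENNReal := fun x =>
    ‖F x‖ₑ * ENNReal.ofReal (polyKernel (fun j => A j + 2) B z x) with hh
  have hhp : ∀ x ∈ polydisc n, h x ^ p = ‖F x‖ₑ ^ p * ENNReal.ofReal
      (polyKernel (fun j => p * (A j + 2)) (fun j => p * B j) z x) := by
    intro x hx
    simp only [hh]
    rw [ENNReal.mul_rpow_of_nonneg _ _ hp0.le,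
      ENNReal.ofReal_rpow_of_nonneg (polyKernel_nonneg _ _ _ hx) hp0.le, polyKernel_rpow _ _ _ _ hx]
  have e1 : ∫⁻ x in polydisc n, h x * v x =
      ∫⁻ x in polydisc n, ‖F x‖ₑ * ENNReal.ofReal (polyKernel A B z x) := by
    refine setLIntegral_congr_fun (measurableSet_polydisc n) fun x hx => ?_
    simp only [hh, hv]
    rw [mul_assoc, ← ENNReal.ofReal_mul (polyKernel_nonneg _ _ _ hx),
      polyKernel_mul_prod_defect_rpow _ _ (fun _ => -2) _ hx]
    simp
  have e2 : ∫⁻ x in polydisc n, h x ^ p * v x = ∫⁻ x in polydisc n, ‖F x‖ₑ ^ p * ENNReal.ofReal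
      (polyKernel (fun j => p * (A j + 2) - 2) (fun j => p * B j) z x) := by
    refine setLIntegral_congr_fun (measurableSet_polydisc n) fun x hx => ?_
    simp only [hv]
    rw [hhp x hx, mul_assoc, ← ENNReal.ofReal_mul (polyKernel_nonneg _ _ _ hx),
      polyKernel_mul_prod_defect_rpow _ _ (fun _ => -2) _ hx]
    rfl
  rw [← e1, ← e2]
  refine rpow_lintegral_mul_le hp0 hp1 hC0 hCt ?_
  filter_upwards [ae_restrict_mem (measurableSet_polydisc n)] with x hx
  rw [e2, hhp x hx]
  exact enorm_rpow_mul_polyKernel_le hp0 hp1 _ _ hF hz hx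

/-! ### Weighted estimates on the polydisc -/

/-- The product weight `∏ ω_j(1 - |z_j|) (1 - |z_j|^2)^(e_j)`. -/
noncomputable def polyWeight {n : ℕ} (ω : Fin n → ℝ → ℝ) (e : Fin n → ℝ) (z : Fin n → ℂ) : ℝ :=
  ∏ j, ω j (1 - ‖z j‖) * defect (z j) ^ e j

theorem measurable_weight {ω : ℝ → ℝ} (hω : Measurable ω) (e : ℝ) :
    Measurable fun z : ℂ => ω (1 - ‖z‖) * defect z ^ e := by
  unfold defect
  exact (hω.comp (by fun_prop)).mul (Measurable.pow_const (by fun_prop) _)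

theorem measurable_polyWeight {n : ℕ} {ω : Fin n → ℝ → ℝ} (hω : ∀ j, Measurable (ω j))
    (e : Fin n → ℝ) : Measurable (polyWeight ω e) :=
  Finset.measurable_prod _ fun j _ => (measurable_weight (hω j) (e j)).comp (measurable_pi_apply j)

section

variable {n : ℕ} {ω : Fin n → ℝ → ℝ} {a b K : Fin n → ℝ}

theorem weight_nonneg (h : ∀ j, IsPowerBetween (ω j) (a j) (b j) (K j)) (e : ℝ)
    {z : Fin n → ℂ} (hz : z ∈ polydisc n) (hz0 : ∀ j, z j ≠ 0) (j : Fin n) :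
    0 ≤ ω j (1 - ‖z j‖) * defect (z j) ^ e :=
  mul_nonneg ((h j).pos _ (one_sub_norm_mem_Ioo (hz0 j) (hz j))).le
    (Real.rpow_nonneg (defect_pos (hz j)).le _)

theorem ofReal_polyWeight (h : ∀ j, IsPowerBetween (ω j) (a j) (b j) (K j)) (e : Fin n → ℝ)
    {z : Fin n → ℂ} (hz : z ∈ polydisc n) (hz0 : ∀ j, z j ≠ 0) :
    ENNReal.ofReal (polyWeight ω e z) =
      ∏ j, ENNReal.ofReal (ω j (1 - ‖z j‖) * defect (z j) ^ e j) :=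
  ENNReal.ofReal_prod_of_nonneg fun j _ => weight_nonneg h _ hz hz0 j

/-- The weighted Forelli–Rudin estimate on the polydisc. -/
theorem exists_lintegral_polyKernel_mul_polyWeight_le
    (h : ∀ j, IsPowerBetween (ω j) (a j) (b j) (K j)) {s t : Fin n → ℝ} (D : Fin n → ℝ)
    (hs : ∀ j, 1 < b j + s j) (ht : ∀ j, a j + s j < t j) :
    ∃ C : ENNReal, C ≠ ⊤ ∧ ∀ x ∈ polydisc n, (∀ j, x j ≠ 0) →
      ∫⁻ z in polydisc n, ENNReal.ofReal (polyKernel D t z x) *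
        ENNReal.ofReal (polyWeight ω (fun j => s j - 2) z) ≤
        C * ENNReal.ofReal (polyWeight ω (fun j => D j + s j - t j) x) := by
  choose C hC0 hC using fun j => (h j).exists_lintegral_le (hs j) (ht j)
  refine ⟨∏ j, ENNReal.ofReal (C j), ENNReal.prod_ne_top fun j _ => ENNReal.ofReal_ne_top,
    fun x hx hx0 => ?_⟩
  set g : Fin n → ℂ → ENNReal := fun j z => ENNReal.ofReal (defect (x j) ^ D j) * ENNReal.ofReal
    (ω j (1 - ‖z‖) * defect z ^ (s j - 2) / ‖1 - z * (starRingEnd ℂ) (x j)‖ ^ t j) with hg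
  have hgm : ∀ j, Measurable (g j) := fun j => by
    have h1 : Continuous fun z : ℂ => ‖1 - z * (starRingEnd ℂ) (x j)‖ := by fun_prop
    exact (((measurable_weight (h j).measurable _).div
      (h1.measurable.pow_const _)).ennreal_ofReal).const_mul _
  calc ∫⁻ z in polydisc n, ENNReal.ofReal (polyKernel D t z x) *
        ENNReal.ofReal (polyWeight ω (fun j => s j - 2) z)
      = ∫⁻ z in polydisc n, ∏ j, g j (z j) := by
        refine lintegral_congr_ae ((ae_restrict_polydisc_ne_zero n).mono fun z hz => ?_)
        simp only [hg]
        rw [ofReal_polyKernel _ _ _ hx, ofReal_polyWeight h _ hz.1 hz.2, ← Finset.prod_mul_distrib]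
        refine Finset.prod_congr rfl fun j _ => ?_
        rw [← ENNReal.ofReal_mul (discKernel_nonneg _ _ _ (hx j)),
          ← ENNReal.ofReal_mul (Real.rpow_nonneg (defect_pos (hx j)).le _)]
        congr 1
        rw [discKernel]
        ring
    _ = ∏ j, ∫⁻ z in ball (0 : ℂ) 1, g j z := by
        rw [volume_restrict_polydisc, lintegral_pi_prod _ hgm]
    _ ≤ ∏ j, ENNReal.ofReal (C j) *
          ENNReal.ofReal (ω j (1 - ‖x j‖) * defect (x j) ^ (D j + s j - t j)) := by
        refine Finset.prod_le_prod' fun j _ => ?_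
        simp only [hg]
        have hd := defect_pos (hx j)
        rw [lintegral_const_mul' _ _ ENNReal.ofReal_ne_top]
        refine (mul_le_mul' le_rfl (hC j (x j) (hx0 j) (hx j))).trans (le_of_eq ?_)
        rw [← ENNReal.ofReal_mul (by positivity), ← ENNReal.ofReal_mul (hC0 j), add_sub_assoc,
          Real.rpow_add hd]
        congr 1
        ring
    _ = _ := by rw [Finset.prod_mul_distrib, ofReal_polyWeight h _ hx hx0]

/-- The basic weighted inequality: an integral operator with product kernel, applied to the modulus
of a holomorphic function, is bounded between weighted `L^p` spaces, `p ≤ 1`. -/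
theorem exists_lintegral_rpow_mul_polyWeight_le
    (h : ∀ j, IsPowerBetween (ω j) (a j) (b j) (K j)) {p : ℝ} (hp0 : 0 < p) (hp1 : p ≤ 1)
    (A : Fin n → ℝ) {B s : Fin n → ℝ}
    (hs : ∀ j, 1 < b j + s j) (ht : ∀ j, a j + s j < p * B j) :
    ∃ C : ENNReal, C ≠ ⊤ ∧ ∀ F : (Fin n → ℂ) → ℂ, DifferentiableOn ℂ F (polydisc n) →
      ∫⁻ z in polydisc n,
        (∫⁻ x in polydisc n, ‖F x‖ₑ * ENNReal.ofReal (polyKernel A B z x)) ^ p *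
          ENNReal.ofReal (polyWeight ω (fun j => s j - 2) z) ≤
        C * ∫⁻ x in polydisc n, ‖F x‖ₑ ^ p *
          ENNReal.ofReal (polyWeight ω (fun j => p * (A j + 2) - 2 + s j - p * B j) x) := by
  obtain ⟨C₁, hC₁, h₁⟩ := exists_rpow_lintegral_mul_polyKernel_le hp0 hp1 A B
  obtain ⟨C₂, hC₂, h₂⟩ := exists_lintegral_polyKernel_mul_polyWeight_le h
    (fun j => p * (A j + 2) - 2) hs ht
  refine ⟨C₁ * C₂, ENNReal.mul_ne_top hC₁ hC₂, fun F hF => ?_⟩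
  set κ : (Fin n → ℂ) → (Fin n → ℂ) → ENNReal := fun z x => ENNReal.ofReal
    (polyKernel (fun j => p * (A j + 2) - 2) (fun j => p * B j) z x) with hκ
  set W : (Fin n → ℂ) → ENNReal := fun z =>
    ENNReal.ofReal (polyWeight ω (fun j => s j - 2) z) with hW
  have hWm : Measurable W :=
    (measurable_polyWeight (fun j => (h j).measurable) _).ennreal_ofReal
  have hκm : Measurable fun q : (Fin n → ℂ) × (Fin n → ℂ) => κ q.1 q.2 :=
    (measurable_polyKernel _ _).ennreal_ofReal
  have hFm : AEMeasurable (fun x => ‖F x‖ₑ ^ p) (volume.restrict (polydisc n)) :=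
    (ENNReal.continuous_rpow_const.comp_continuousOn
      hF.continuousOn.enorm).aemeasurable (measurableSet_polydisc n)
  calc ∫⁻ z in polydisc n,
        (∫⁻ x in polydisc n, ‖F x‖ₑ * ENNReal.ofReal (polyKernel A B z x)) ^ p * W z
      ≤ ∫⁻ z in polydisc n, C₁ * ∫⁻ x in polydisc n, ‖F x‖ₑ ^ p * κ z x * W z := by
        refine setLIntegral_mono' (measurableSet_polydisc n) fun z hz => ?_
        rw [lintegral_mul_const' _ _ ENNReal.ofReal_ne_top, ← mul_assoc]
        gcongr
        exact h₁ F hF z hz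
    _ = C₁ * ∫⁻ x in polydisc n, ∫⁻ z in polydisc n, ‖F x‖ₑ ^ p * κ z x * W z := by
        rw [lintegral_const_mul' _ _ hC₁, lintegral_lintegral_swap]
        exact (hFm.comp_snd.mul hκm.aemeasurable).mul (hWm.comp measurable_fst).aemeasurable
    _ ≤ C₁ * ∫⁻ x in polydisc n, C₂ * (‖F x‖ₑ ^ p *
          ENNReal.ofReal (polyWeight ω (fun j => p * (A j + 2) - 2 + s j - p * B j) x)) := by
        gcongr C₁ * ?_
        refine lintegral_mono_ae ((ae_restrict_polydisc_ne_zero n).mono fun x hx => ?_)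
        simp only [mul_assoc]
        rw [lintegral_const_mul' _ _
          (ENNReal.rpow_ne_top_of_nonneg hp0.le enorm_ne_top), mul_left_comm]
        gcongr
        exact h₂ x hx.1 hx.2
    _ = _ := by rw [lintegral_const_mul' _ _ hC₂, mul_assoc]

/-- The inclusion of the Besov space in the weighted Lebesgue space is bounded. -/
theorem exists_lintegral_le_lintegral_diffD
    (h : ∀ j, IsPowerBetween (ω j) (a j) (b j) (K j)) {p : ℝ} (hp0 : 0 < p) (hp1 : p ≤ 1) :
    ∃ C : ENNReal, C ≠ ⊤ ∧ ∀ f : (Fin n → ℂ) → ℂ, DifferentiableOn ℂ f (polydisc n) →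
      ∫⁻ z in polydisc n, ‖f z‖ₑ ^ p * ENNReal.ofReal (polyWeight ω (fun _ => -2) z) ≤
        C * ∫⁻ z in polydisc n, ‖diffD f z‖ₑ ^ p *
          ENNReal.ofReal (polyWeight ω (fun _ => p - 2) z) := by
  -- The exponent `N` only has to satisfy `p * N > a`.
  set N : Fin n → ℝ := fun j => (a j + 1) / p with hN
  have hpN : ∀ j, p * N j = a j + 1 := fun j => mul_div_cancel₀ _ hp0.ne'
  have hN0 : ∀ j, 0 ≤ N j := fun j => by
    have h1 := (h j).one_lt
    have h2 := (h j).le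
    exact div_nonneg (by linarith) hp0.le
  obtain ⟨C, hC, hI⟩ := exists_lintegral_rpow_mul_polyWeight_le h hp0 hp1 (fun j => N j - 1)
    (B := N) (s := fun _ => 0) (fun j => by simpa using (h j).one_lt)
    (fun j => by rw [hpN]; linarith)
  set c : ENNReal := ENNReal.ofReal (∏ j, 144 * 5 ^ N j * subMeanConst 1) with hc
  have hcp : c ^ p ≠ ⊤ := ENNReal.rpow_ne_top_of_nonneg hp0.le ENNReal.ofReal_ne_top
  refine ⟨c ^ p * C, ENNReal.mul_ne_top hcp hC, fun f hf => ?_⟩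
  have hDf : DifferentiableOn ℂ (diffD f) (polydisc n) := by
    rw [diffD_eq_foldr_coordD]
    exact differentiableOn_foldr_coordD _ hf
  have hI' := hI (diffD f) hDf
  have he : ∀ j, p * (N j - 1 + 2) - 2 + 0 - p * N j = p - 2 := fun j => by ring
  simp only [zero_sub, he] at hI'
  calc ∫⁻ z in polydisc n, ‖f z‖ₑ ^ p * ENNReal.ofReal (polyWeight ω (fun _ => -2) z)
      ≤ ∫⁻ z in polydisc n, c ^ p * ((∫⁻ x in polydisc n, ‖diffD f x‖ₑ *
          ENNReal.ofReal (polyKernel (fun j => N j - 1) N z x)) ^ p *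
          ENNReal.ofReal (polyWeight ω (fun _ => -2) z)) := by
        refine setLIntegral_mono' (measurableSet_polydisc n) fun z hz => ?_
        rw [← mul_assoc, ← ENNReal.mul_rpow_of_nonneg _ _ hp0.le]
        gcongr
        exact enorm_le_lintegral_diffD_mul_polyKernel hN0 hf hz
    _ ≤ _ := by
        rw [lintegral_const_mul' _ _ hcp, mul_assoc]
        gcongr

/-- The weight is bounded below by the power `a` of the defining function. -/
theorem IsPowerBetween.exists_defect_rpow_le {ω : ℝ → ℝ} {a b K : ℝ} (h : IsPowerBetween ω a b K) :
    ∃ C : ℝ, 0 ≤ C ∧ ∀ x : ℂ, x ≠ 0 → ‖x‖ < 1 → defect x ^ a ≤ C * ω (1 - ‖x‖) := by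
  have hhalf : (1 / 2 : ℝ) ∈ Set.Ioo (0 : ℝ) 1 := by constructor <;> norm_num
  have hω := h.pos _ hhalf
  have hK := h.const_pos
  have hb := h.one_lt
  have hba := h.le
  refine ⟨2 ^ a * (2 * K / ω (1 / 2)), by positivity, fun x hx0 hx => ?_⟩
  set ρ := 1 - ‖x‖ with hρ
  have hρI : ρ ∈ Set.Ioo (0 : ℝ) 1 := one_sub_norm_mem_Ioo hx0 hx
  have hρ0 := hρI.1
  have hωρ := h.pos ρ hρI
  have h1 := h.bound _ hhalf ρ hρI
  have h2 : (1 / 2 / ρ) ^ a ≤ ρ⁻¹ ^ a := by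
    refine Real.rpow_le_rpow (by positivity) ?_ (by linarith)
    rw [div_eq_mul_inv]
    linarith [inv_pos.2 hρ0]
  have h3 : (1 / 2 / ρ) ^ b ≤ ρ⁻¹ ^ a := by
    calc (1 / 2 / ρ) ^ b ≤ ρ⁻¹ ^ b := by
          refine Real.rpow_le_rpow (by positivity) ?_ (by linarith)
          rw [div_eq_mul_inv]
          linarith [inv_pos.2 hρ0]
      _ ≤ ρ⁻¹ ^ a := Real.rpow_le_rpow_of_exponent_le ((one_le_inv₀ hρ0).2 hρI.2.le) hba
  have h4 : ω (1 / 2) ≤ K * ω ρ * (2 * ρ⁻¹ ^ a) := by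
    refine h1.trans ?_
    gcongr
    linarith
  have h5 : ρ ^ a * ρ⁻¹ ^ a = 1 := by
    rw [← Real.mul_rpow hρ0.le (by positivity), mul_inv_cancel₀ hρ0.ne', Real.one_rpow]
  have hρa : 0 < ρ ^ a := by positivity
  have h6 : ρ ^ a ≤ 2 * K / ω (1 / 2) * ω ρ := by
    rw [div_mul_eq_mul_div, le_div_iff₀ hω]
    calc ρ ^ a * ω (1 / 2) ≤ ρ ^ a * (K * ω ρ * (2 * ρ⁻¹ ^ a)) := by gcongr
      _ = 2 * K * ω ρ * (ρ ^ a * ρ⁻¹ ^ a) := by ring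
      _ = _ := by rw [h5, mul_one]
  calc defect x ^ a ≤ (2 * ρ) ^ a :=
        Real.rpow_le_rpow (defect_pos hx).le (defect_le hx) (by linarith)
    _ = 2 ^ a * ρ ^ a := Real.mul_rpow (by norm_num) hρ0.le
    _ ≤ 2 ^ a * (2 * K / ω (1 / 2) * ω ρ) := by gcongr
    _ = _ := by ring

/-- For a fixed point `z` the kernel is bounded by the weight, so that the integrals against it
converge. -/
theorem exists_polyKernel_le_polyWeight (h : ∀ j, IsPowerBetween (ω j) (a j) (b j) (K j))
    {D B : Fin n → ℝ} (hB : ∀ j, 0 ≤ B j) (e : Fin n → ℝ) (hD : ∀ j, a j + e j ≤ D j)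
    {z : Fin n → ℂ} (hz : z ∈ polydisc n) :
    ∃ C : ℝ, 0 ≤ C ∧ ∀ x ∈ polydisc n, (∀ j, x j ≠ 0) →
      polyKernel D B z x ≤ C * polyWeight ω e x := by
  choose C hC0 hC using fun j => (h j).exists_defect_rpow_le
  refine ⟨∏ j, C j / (1 - ‖z j‖) ^ B j, Finset.prod_nonneg fun j _ =>
    div_nonneg (hC0 j) (Real.rpow_nonneg (by linarith [hz j]) _), fun x hx hx0 => ?_⟩
  rw [polyKernel, polyWeight, ← Finset.prod_mul_distrib]
  refine Finset.prod_le_prod (fun j _ => discKernel_nonneg _ _ _ (hx j)) fun j _ => ?_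
  have hd := defect_pos (hx j)
  have hd1 : defect (x j) ≤ 1 := by unfold defect; nlinarith [norm_nonneg (x j)]
  have hz1 : 0 < 1 - ‖z j‖ := by linarith [hz j]
  have h1 : 1 - ‖z j‖ ≤ ‖1 - z j * (starRingEnd ℂ) (x j)‖ := by
    have := norm_sub_norm_le 1 (z j * (starRingEnd ℂ) (x j))
    rw [norm_one, norm_mul, RCLike.norm_conj] at this
    nlinarith [norm_nonneg (z j), hx j]
  have hωx := (h j).pos _ (one_sub_norm_mem_Ioo (hx0 j) (hx j))
  calc discKernel (D j) (B j) (z j) (x j)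
      ≤ (defect (x j) ^ a j * defect (x j) ^ e j) / (1 - ‖z j‖) ^ B j := by
        rw [discKernel, ← Real.rpow_add hd]
        have h2 := Real.rpow_le_rpow_of_exponent_ge hd hd1 (hD j)
        have h3 := Real.rpow_le_rpow hz1.le h1 (hB j)
        gcongr
    _ ≤ (C j * ω j (1 - ‖x j‖) * defect (x j) ^ e j) / (1 - ‖z j‖) ^ B j := by
        have h2 := hC j (x j) (hx0 j) (hx j)
        gcongr
    _ = _ := by ring

end

/-! ### The operator `B^α_g` -/

theorem lNorm_eq_rpow_lintegral {n : ℕ} (p : ℝ) {ω ω' : Fin n → ℝ → ℝ}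
    (hω : ∀ j, Set.EqOn (ω' j) (ω j) (Set.Ioo 0 1)) (f : (Fin n → ℂ) → ℂ) :
    lNorm p ω f = (∫⁻ z in polydisc n, ‖f z‖ₑ ^ p *
      ENNReal.ofReal (polyWeight ω' (fun _ => -2) z)) ^ (1 / p) := by
  rw [lNorm]
  congr 1
  refine lintegral_congr_ae ((ae_restrict_polydisc_ne_zero n).mono fun z hz => ?_)
  simp only [polyWeight]
  congr 2
  refine Finset.prod_congr rfl fun j _ => ?_
  have hd := defect_pos (hz.1 j)
  rw [hω j (one_sub_norm_mem_Ioo (hz.2 j) (hz.1 j)), Real.rpow_neg hd.le, Real.rpow_two,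
    div_eq_mul_inv, defect]

theorem bNorm_eq_rpow_lintegral {n : ℕ} (p : ℝ) {ω ω' : Fin n → ℝ → ℝ}
    (hω : ∀ j, Set.EqOn (ω' j) (ω j) (Set.Ioo 0 1)) (f : (Fin n → ℂ) → ℂ) :
    bNorm p ω f = (∫⁻ z in polydisc n, ‖diffD f z‖ₑ ^ p *
      ENNReal.ofReal (polyWeight ω' (fun _ => p - 2) z)) ^ (1 / p) := by
  rw [bNorm]
  congr 1
  refine lintegral_congr_ae ((ae_restrict_polydisc_ne_zero n).mono fun z hz => ?_)
  simp only [polyWeight]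
  congr 2
  refine Finset.prod_congr rfl fun j _ => ?_
  have hd := defect_pos (hz.1 j)
  rw [hω j (one_sub_norm_mem_Ioo (hz.2 j) (hz.1 j)), ← neg_sub 2 p, Real.rpow_neg hd.le,
    div_eq_mul_inv, defect]

theorem berezinIntegrand_eq {n : ℕ} (α : Fin n → ℝ) (g f : (Fin n → ℂ) → ℂ) (z x : Fin n → ℂ) :
    berezinIntegrand α g f z x =
      ((polyKernel α (fun j => 4 + 2 * α j) z x : ℝ) : ℂ) * f x * g x := rfl

theorem aestronglyMeasurable_berezinIntegrand {n : ℕ} (α : Fin n → ℝ) {g f : (Fin n → ℂ) → ℂ}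
    (hg : AEStronglyMeasurable g (volume.restrict (polydisc n)))
    (hf : AEStronglyMeasurable f (volume.restrict (polydisc n))) :
    AEStronglyMeasurable (fun q : (Fin n → ℂ) × (Fin n → ℂ) => berezinIntegrand α g f q.1 q.2)
      ((volume.restrict (polydisc n)).prod (volume.restrict (polydisc n))) := by
  simp only [berezinIntegrand_eq]
  exact ((Complex.measurable_ofReal.comp
    (measurable_polyKernel _ _)).aestronglyMeasurable.mul hf.comp_snd).mul hg.comp_snd

theorem aestronglyMeasurable_berezinIntegrand_right {n : ℕ} (α : Fin n → ℝ)
    {g f : (Fin n → ℂ) → ℂ}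
    (hg : AEStronglyMeasurable g (volume.restrict (polydisc n)))
    (hf : AEStronglyMeasurable f (volume.restrict (polydisc n))) (z : Fin n → ℂ) :
    AEStronglyMeasurable (berezinIntegrand α g f z) (volume.restrict (polydisc n)) := by
  have h1 : berezinIntegrand α g f z = fun x =>
      ((polyKernel α (fun j => 4 + 2 * α j) z x : ℝ) : ℂ) * f x * g x := rfl
  rw [h1]
  exact ((Complex.measurable_ofReal.comp
    (measurable_polyKernel_right _ _ _)).aestronglyMeasurable.mul hf).mul hg

theorem aestronglyMeasurable_berezin {n : ℕ} (α : Fin n → ℝ) {g f : (Fin n → ℂ) → ℂ}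
    (hg : AEStronglyMeasurable g (volume.restrict (polydisc n)))
    (hf : AEStronglyMeasurable f (volume.restrict (polydisc n))) :
    AEStronglyMeasurable (berezin α g f) (volume.restrict (polydisc n)) := by
  have h1 := (aestronglyMeasurable_berezinIntegrand α hg hf).integral_prod_right'
  have h2 : Measurable fun z : Fin n → ℂ =>
      (∏ j, (α j + 1)) / Real.pi ^ n * ∏ j, (1 - ‖z j‖ ^ 2) ^ (α j + 2) :=
    (Finset.measurable_prod _ fun j _ => Measurable.pow_const (by fun_prop) _).const_mul _
  exact (Complex.measurable_ofReal.comp h2).aestronglyMeasurable.mul h1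

theorem lintegral_enorm_berezinIntegrand_le {n : ℕ} (α : Fin n → ℝ) {g f h : (Fin n → ℂ) → ℂ}
    (hg : eLpNorm g ⊤ (volume.restrict (polydisc n)) ≠ ⊤)
    (hfh : ∀ z, ‖f z‖ = ‖h z‖) (z : Fin n → ℂ) :
    ∫⁻ x in polydisc n, ‖berezinIntegrand α g f z x‖ₑ ≤
      eLpNorm g ⊤ (volume.restrict (polydisc n)) *
        ∫⁻ x in polydisc n, ‖h x‖ₑ *
          ENNReal.ofReal (polyKernel α (fun j => 4 + 2 * α j) z x) := by
  rw [eLpNorm_exponent_top]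
  calc ∫⁻ x in polydisc n, ‖berezinIntegrand α g f z x‖ₑ
      ≤ ∫⁻ x in polydisc n, (‖h x‖ₑ *
          ENNReal.ofReal (polyKernel α (fun j => 4 + 2 * α j) z x)) *
          eLpNormEssSup g (volume.restrict (polydisc n)) := by
        refine lintegral_mono_ae ?_
        filter_upwards [enorm_ae_le_eLpNormEssSup g (volume.restrict (polydisc n)),
          ae_restrict_mem (measurableSet_polydisc n)] with x hgx hx
        have h1 : ‖f x‖ₑ = ‖h x‖ₑ := by rw [← ofReal_norm, hfh, ofReal_norm]
        have h2 : ‖((polyKernel α (fun j => 4 + 2 * α j) z x : ℝ) : ℂ)‖ₑ =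
            ENNReal.ofReal (polyKernel α (fun j => 4 + 2 * α j) z x) := by
          rw [← ofReal_norm, Complex.norm_real, Real.norm_of_nonneg (polyKernel_nonneg _ _ _ hx)]
        rw [berezinIntegrand_eq, enorm_mul, enorm_mul, h1, h2,
          mul_comm (ENNReal.ofReal _) ‖h x‖ₑ]
        gcongr
    _ ≤ _ := by
        rw [lintegral_mul_const' _ _ (by rwa [eLpNorm_exponent_top] at hg), mul_comm]

theorem enorm_berezin_le {n : ℕ} (α : Fin n → ℝ) {g f h : (Fin n → ℂ) → ℂ}
    (hg : eLpNorm g ⊤ (volume.restrict (polydisc n)) ≠ ⊤)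
    (hfh : ∀ z, ‖f z‖ = ‖h z‖) {z : Fin n → ℂ} (hz : z ∈ polydisc n) :
    ‖berezin α g f z‖ₑ ≤ ENNReal.ofReal |(∏ j, (α j + 1)) / Real.pi ^ n| *
      ENNReal.ofReal (∏ j, defect (z j) ^ (α j + 2)) *
      (eLpNorm g ⊤ (volume.restrict (polydisc n)) * ∫⁻ x in polydisc n, ‖h x‖ₑ *
          ENNReal.ofReal (polyKernel α (fun j => 4 + 2 * α j) z x)) := by
  have hd : 0 ≤ ∏ j, defect (z j) ^ (α j + 2) :=
    Finset.prod_nonneg fun j _ => Real.rpow_nonneg (defect_pos (hz j)).le _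
  have h1 : ‖(((∏ j, (α j + 1)) / Real.pi ^ n * ∏ j, (1 - ‖z j‖ ^ 2) ^ (α j + 2) : ℝ) : ℂ)‖ₑ =
      ENNReal.ofReal |(∏ j, (α j + 1)) / Real.pi ^ n| *
      ENNReal.ofReal (∏ j, defect (z j) ^ (α j + 2)) := by
    rw [← ENNReal.ofReal_mul (abs_nonneg _), ← ofReal_norm, Complex.norm_real, Real.norm_eq_abs,
      abs_mul]
    congr 2
    exact abs_of_nonneg hd
  rw [berezin, enorm_mul, h1]
  gcongr
  exact (enorm_integral_le_lintegral_enorm _).trans (lintegral_enorm_berezinIntegrand_le α hg hfh z)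

/-- The estimate for `B^α_g f` when `f` has the modulus of a function in the Besov space; this
covers holomorphic and antiholomorphic `f` at once. -/
theorem exists_lNorm_berezin_le {n : ℕ} {p : ℝ} (hp0 : 0 < p) (hp1 : p < 1)
    {ω ω' : Fin n → ℝ → ℝ} {a b K : Fin n → ℝ}
    (hω : ∀ j, Set.EqOn (ω' j) (ω j) (Set.Ioo 0 1))
    (hp : ∀ j, IsPowerBetween (ω' j) (a j) (b j) (K j))
    (α : Fin n → ℝ) (hα : ∀ j, a j / p - 2 < α j) :
    ∃ C : NNReal, ∀ f g h : (Fin n → ℂ) → ℂ,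
      MemLp g ⊤ (volume.restrict (polydisc n)) → MemB p ω h → (∀ z, ‖f z‖ = ‖h z‖) →
      AEStronglyMeasurable f (volume.restrict (polydisc n)) →
        (∀ z ∈ polydisc n, IntegrableOn (berezinIntegrand α g f z) (polydisc n)) ∧
        MemL p ω (berezin α g f) ∧
        lNorm p ω (berezin α g f) ≤
          C * eLpNorm g ⊤ (volume.restrict (polydisc n)) * bNorm p ω h := by
  have hαp : ∀ j, a j < p * (α j + 2) := fun j => by
    have h1 := hα j
    rw [sub_lt_iff_lt_add, div_lt_iff₀ hp0] at h1
    linarith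
  have hab : ∀ j, 1 < a j := fun j => (hp j).one_lt.trans_le (hp j).le
  obtain ⟨C₁, hC₁, h₁⟩ := exists_lintegral_le_lintegral_diffD hp hp0 hp1.le
  obtain ⟨C₂, hC₂, h₂⟩ := exists_lintegral_rpow_mul_polyWeight_le hp hp0 hp1.le α
    (B := fun j => 4 + 2 * α j) (s := fun j => p * (α j + 2))
    (fun j => by have := (hp j).one_lt; have := hab j; have := hαp j; linarith)
    (fun j => by have := hαp j; linarith)
  obtain ⟨C₃, hC₃, h₃⟩ := exists_rpow_lintegral_mul_polyKernel_le hp0 hp1.le α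
    (fun j => 4 + 2 * α j)
  have he : ∀ j, p * (α j + 2) - 2 + p * (α j + 2) - p * (4 + 2 * α j) = -2 := fun j => by ring
  simp only [he] at h₂
  set c : ENNReal := ENNReal.ofReal |(∏ j, (α j + 1)) / Real.pi ^ n| with hc
  set C : ENNReal := c * (C₂ * C₁) ^ (1 / p) with hC
  have hp1' : 0 ≤ 1 / p := by positivity
  have hCt : C ≠ ⊤ := ENNReal.mul_ne_top ENNReal.ofReal_ne_top
    (ENNReal.rpow_ne_top_of_nonneg hp1' (ENNReal.mul_ne_top hC₂ hC₁))
  refine ⟨C.toNNReal, fun f g h hg hh hfh hf => ?_⟩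
  rw [ENNReal.coe_toNNReal hCt]
  set G := eLpNorm g ⊤ (volume.restrict (polydisc n)) with hG
  have hGt : G ≠ ⊤ := hg.2.ne
  set E : (Fin n → ℂ) → ENNReal := fun z => ∫⁻ x in polydisc n, ‖h x‖ₑ *
    ENNReal.ofReal (polyKernel α (fun j => 4 + 2 * α j) z x) with hE
  set S := ∫⁻ x in polydisc n, ‖h x‖ₑ ^ p *
    ENNReal.ofReal (polyWeight ω' (fun _ => -2) x) with hS
  set D := ∫⁻ x in polydisc n, ‖diffD h x‖ₑ ^ p *
    ENNReal.ofReal (polyWeight ω' (fun _ => p - 2) x) with hD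
  have hbD : bNorm p ω h = D ^ (1 / p) := bNorm_eq_rpow_lintegral p hω h
  have hDt : D ≠ ⊤ := fun h => by
    have h1 := hh.2
    rw [hbD, h, ENNReal.top_rpow_of_pos (by positivity)] at h1
    exact lt_irrefl _ h1
  have hSD : S ≤ C₁ * D := h₁ h hh.1
  have hSt : S ≠ ⊤ := ne_top_of_le_ne_top (ENNReal.mul_ne_top hC₁ hDt) hSD
  have hEt : ∀ z ∈ polydisc n, E z ≠ ⊤ := by
    intro z hz hEz
    obtain ⟨c₄, hc₄, h₄⟩ := exists_polyKernel_le_polyWeight hp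
      (D := fun j => p * (α j + 2) - 2) (B := fun j => p * (4 + 2 * α j))
      (fun j => by have := hαp j; have := hab j; linarith) (fun _ => -2)
      (fun j => by have := hαp j; linarith) hz
    have h5 : E z ^ p ≤ C₃ * (ENNReal.ofReal c₄ * S) := by
      refine (h₃ h hh.1 z hz).trans ?_
      gcongr
      rw [hS, ← lintegral_const_mul' _ _ ENNReal.ofReal_ne_top]
      refine lintegral_mono_ae ((ae_restrict_polydisc_ne_zero n).mono fun x hx => ?_)
      rw [mul_left_comm, ← ENNReal.ofReal_mul hc₄]
      gcongr
      exact h₄ x hx.1 hx.2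
    rw [hEz, ENNReal.top_rpow_of_pos hp0, top_le_iff] at h5
    exact ENNReal.mul_ne_top hC₃ (ENNReal.mul_ne_top ENNReal.ofReal_ne_top hSt) h5
  have hbound : lNorm p ω (berezin α g f) ≤ C * G * bNorm p ω h := by
    have hcG : (c * G) ^ p ≠ ⊤ :=
      ENNReal.rpow_ne_top_of_nonneg hp0.le (ENNReal.mul_ne_top ENNReal.ofReal_ne_top hGt)
    have h6 : ∫⁻ z in polydisc n, ‖berezin α g f z‖ₑ ^ p *
        ENNReal.ofReal (polyWeight ω' (fun _ => -2) z) ≤ (c * G) ^ p * (C₂ * (C₁ * D)) := by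
      calc ∫⁻ z in polydisc n, ‖berezin α g f z‖ₑ ^ p *
            ENNReal.ofReal (polyWeight ω' (fun _ => -2) z)
          ≤ ∫⁻ z in polydisc n, (c * G) ^ p * (E z ^ p *
              ENNReal.ofReal (polyWeight ω' (fun j => p * (α j + 2) - 2) z)) := by
            refine lintegral_mono_ae ((ae_restrict_polydisc_ne_zero n).mono fun z hz => ?_)
            have hdj : ∀ j, 0 ≤ defect (z j) ^ (α j + 2) := fun j =>
              Real.rpow_nonneg (defect_pos (hz.1 j)).le _
            have hd : 0 ≤ ∏ j, defect (z j) ^ (α j + 2) := Finset.prod_nonneg fun j _ => hdj j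
            have h7 : ENNReal.ofReal (∏ j, defect (z j) ^ (α j + 2)) ^ p *
                ENNReal.ofReal (polyWeight ω' (fun _ => -2) z) =
                ENNReal.ofReal (polyWeight ω' (fun j => p * (α j + 2) - 2) z) := by
              rw [ENNReal.ofReal_rpow_of_nonneg hd hp0.le,
                ← ENNReal.ofReal_mul (Real.rpow_nonneg hd _),
                ← Real.finsetProd_rpow _ _ fun j _ => hdj j, polyWeight, polyWeight,
                ← Finset.prod_mul_distrib]
              congr 1
              refine Finset.prod_congr rfl fun j _ => ?_
              have hdz := defect_pos (hz.1 j)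
              rw [← Real.rpow_mul hdz.le, sub_eq_add_neg (p * (α j + 2)), Real.rpow_add hdz,
                mul_comm (α j + 2)]
              ring
            calc ‖berezin α g f z‖ₑ ^ p * ENNReal.ofReal (polyWeight ω' (fun _ => -2) z)
                ≤ (c * ENNReal.ofReal (∏ j, defect (z j) ^ (α j + 2)) * (G * E z)) ^ p *
                    ENNReal.ofReal (polyWeight ω' (fun _ => -2) z) := by
                  gcongr
                  exact enorm_berezin_le α hGt hfh hz.1
              _ = (c * G) ^ p * (E z ^ p *
                    (ENNReal.ofReal (∏ j, defect (z j) ^ (α j + 2)) ^ p *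
                    ENNReal.ofReal (polyWeight ω' (fun _ => -2) z))) := by
                  simp only [ENNReal.mul_rpow_of_nonneg _ _ hp0.le]
                  ring
              _ = _ := by rw [h7]
        _ ≤ _ := by
            rw [lintegral_const_mul' _ _ hcG]
            gcongr
            refine (h₂ h hh.1).trans ?_
            gcongr
    rw [lNorm_eq_rpow_lintegral p hω, hbD]
    calc _ ≤ ((c * G) ^ p * (C₂ * (C₁ * D))) ^ (1 / p) := by gcongr
      _ = _ := by
        rw [ENNReal.mul_rpow_of_nonneg _ _ hp1', ← mul_assoc C₂,
          ENNReal.mul_rpow_of_nonneg _ D hp1', ← ENNReal.rpow_mul, mul_one_div_cancel hp0.ne',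
          ENNReal.rpow_one, hC]
        ring
  refine ⟨fun z hz => ⟨aestronglyMeasurable_berezinIntegrand_right α hg.1 hf z, ?_⟩,
    ⟨aestronglyMeasurable_berezin α hg.1 hf, hbound.trans_lt ?_⟩, hbound⟩
  · exact (lintegral_enorm_berezinIntegrand_le α hGt hfh z).trans_lt
      (ENNReal.mul_lt_top hGt.lt_top (hEt z hz).lt_top)
  · exact ENNReal.mul_lt_top (ENNReal.mul_lt_top hCt.lt_top hGt.lt_top) hh.2

end WeightedBesov

theorem mainTheorem4 (n : ℕ) (p : ℝ) (hp0 : 0 < p) (hp1 : p < 1)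
    (ω : Fin n → ℝ → ℝ) (m q M : Fin n → ℝ)
    (hω : ∀ j, WeightedBesov.IsClassS (ω j) (m j) (q j) (M j))
    (hβ : ∀ j, ∃ β : ℝ, β < -1 ∧ WeightedBesov.HasUpperExponent (ω j) β)
    (α : Fin n → ℝ) (hα : ∀ j, WeightedBesov.alphaIndex (m j) (q j) / p - 2 < α j) :
    ∃ C : NNReal, ∀ f g : (Fin n → ℂ) → ℂ,
      MemLp g ⊤ (volume.restrict (WeightedBesov.polydisc n)) →
      (WeightedBesov.MemB p ω f →
        (∀ z ∈ WeightedBesov.polydisc n,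
          IntegrableOn (WeightedBesov.berezinIntegrand α g f z) (WeightedBesov.polydisc n)) ∧
        WeightedBesov.MemL p ω (WeightedBesov.berezin α g f) ∧
        WeightedBesov.lNorm p ω (WeightedBesov.berezin α g f) ≤
          C * eLpNorm g ⊤ (volume.restrict (WeightedBesov.polydisc n)) *
            WeightedBesov.bNorm p ω f) ∧
      (WeightedBesov.MemB p ω (fun z => (starRingEnd ℂ) (f z)) →
        (∀ z ∈ WeightedBesov.polydisc n,
          IntegrableOn (WeightedBesov.berezinIntegrand α g f z) (WeightedBesov.polydisc n)) ∧
        WeightedBesov.MemL p ω (WeightedBesov.berezin α g f) ∧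
        WeightedBesov.lNorm p ω (WeightedBesov.berezin α g f) ≤
          C * eLpNorm g ⊤ (volume.restrict (WeightedBesov.polydisc n)) *
            WeightedBesov.bNorm p ω (fun z => (starRingEnd ℂ) (f z))) := by
  choose β hβ1 hβ2 using hβ
  choose ω' K heq hpb using fun j => (hω j).exists_isPowerBetween (hβ1 j) (hβ2 j)
  obtain ⟨C, hC⟩ := WeightedBesov.exists_lNorm_berezin_le hp0 hp1 heq hpb α hα
  have hmeas : ∀ {h : (Fin n → ℂ) → ℂ}, WeightedBesov.MemB p ω h →
      AEStronglyMeasurable h (volume.restrict (WeightedBesov.polydisc n)) := fun hh =>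
    hh.1.continuousOn.aestronglyMeasurable (WeightedBesov.measurableSet_polydisc n)
  refine ⟨C, fun f g hg => ⟨fun hf => hC f g f hg hf (fun _ => rfl) (hmeas hf), fun hf => ?_⟩⟩
  refine hC f g _ hg hf (fun z => (RCLike.norm_conj (f z)).symm) ?_
  -- Conjugating twice recovers `f`, which is therefore measurable.
  have h1 := Complex.continuous_conj.comp_aestronglyMeasurable (hmeas hf)
  simpa using h1
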